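/- Let $K>0$, $\gamma\ge 3$, let $m\ge 1$ be an integer, and put $\kappa=\frac{\gamma-3}{2(\gamma-1)}$. Consider the radially symmetric isentropic Euler equations $$(r^m\rho)_t+(r^m\rho u)_r=0,\qquad (r^m\rho u)_t+(r^m\rho u^2)_r+r^m p_r=0,\qquad p=K\rho^\gamma,$$ with density $\rho>0$, velocity $u$ and sound speed $h=\sqrt{p'(\rho)}=\sqrt{K\gamma}\,\rho^{(\gamma-1)/2}$. The 1- and 2-characteristics are the solutions of $\dot r=u-h$ and $\dot r=u+h$ respectively, and $$\tilde\alpha=h^{\kappa}\Big(u_r+\tfrac{2}{\gamma-1}h_r+\frac{mhu}{r(u+h)}\Big),\qquad \tilde\beta=h^{\kappa}\Big(u_r-\tfrac{2}{\gamma-1}h_r-\frac{mhu}{r(u-h)}\Big).$$ Let $0<r_0<r_1<r_2$, let $\underline h,\overline h,\underline u,\overline u,\underline\alpha,\overline\alpha,\overline\beta$ be positive constants, and let $h_0,u_0\in C^1([r_1,r_2])$ be initial data, with corresponding $\tilde\alpha_0,\tilde\beta_0$ (the above expressions evaluated at $h_0,u_0$), such that for all $r\in[r_1,r_2]$ $$\underline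 h<h_0(r)<\overline h<\tfrac12\overline u,\qquad -\underline u<u_0(r)<-\overline u,$$ $$\underline\alpha<\tilde\alpha_0(r)<\overline\alpha,\qquad \tilde\beta_0(r)<-\overline\beta,$$ where $$\underline\alpha\ge\frac{2m(\underline u+\overline h)}{r_0}\,\overline h^{\kappa},\qquad \overline\beta>\frac{(\gamma+1)r_2\,\underline\alpha^2}{2m\underline u}\,\underline h^{-\kappa}.$$ Put $\alpha^*=(\overline h/\underline h)^{\frac{\gamma+1}{2(\gamma-1)}}\,\overline\alpha$ and $$\widetilde T=\min\Big\{\frac{r_1-r_0}{\underline u+2\overline h},\ \frac{2}{(\gamma-1)\alpha^*}\underline h^{\kappa}\Big\},$$ and let $0<T\le\widetilde T$. Suppose that for some $r_*\in(r_1,r_2)$ $$\overline h^{-\kappa}\,\tilde\beta_0(r_*)\le -N,\qquad N=N(T,r_*):=\max\Big\{\overline\beta\,\overline h^{-\kappa},\ \frac1T,\ \frac{\underline u+2\overline h}{r_*-r_1}\Big\}.$$ Then $1/N\le T$, and a singularity forms before time $1/N$, in the following sense. Let $\tau>0$ and let $(\rho,u)$ be a smooth ($C^2$) solution with $\rho>0$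 and initial data $h_0,u_0$ on $[r_1,r_2]$, on the region $\{(r,t): 0\le t<\tau,\ \bar r_1(t)\le r\le\bar r_2(t)\}$ between its 2-characteristic $\bar r_1$ with $\bar r_1(0)=r_1$ and its 1-characteristic $\bar r_2$ with $\bar r_2(0)=r_2$. Then $\tau<1/N$. Moreover, the 1-characteristic $X(t)$ with $X(0)=r_*$ exists for $0\le t<\tau$ with $\bar r_1(t)<X(t)<\bar r_2(t)$, and for $0<t<\tau$ $$1+\tilde\beta_0(r_*)\,\overline h^{-\kappa}t>0,\qquad \tilde\beta(X(t),t)<\frac{\tilde\beta_0(r_*)}{1+\tilde\beta_0(r_*)\,\overline h^{-\kappa}\,t},$$ so that $\tilde\beta$ along $X$ is bounded above by a function that tends to $-\infty$ at the time $\overline h^{\kappa}/|\tilde\beta_0(r_*)|\le 1/N$. -/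

import Mathlib

open Set

namespace RadialEuler

noncomputable section

/-- The local sound speed `√(p'(ρ)) = √(Kγ) ρ^((γ-1)/2)` of the gas law `p = K ρ^γ`. -/
def soundSpeed (K γ ρ : ℝ) : ℝ := Real.sqrt (K * γ) * ρ ^ ((γ - 1) / 2)

/-- The exponent `(γ-3)/(2(γ-1))` of the weight. -/
def weightExp (γ : ℝ) : ℝ := (γ - 3) / (2 * (γ - 1))

/-- The weighted rarefaction/compression variable `α̃` of the space profiles `h`, `u` (sound speed
and velocity at a fixed time), given on the interval `s`, at the point `r`. -/
def alphaTilde (γ : ℝ) (m : ℕ) (s : Set ℝ) (h u : ℝ → ℝ) (r : ℝ) : ℝ :=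
  h r ^ weightExp γ *
    (derivWithin u s r + 2 / (γ - 1) * derivWithin h s r
      + m * h r * u r / (r * (u r + h r)))

/-- The weighted rarefaction/compression variable `β̃` of the space profiles `h`, `u`. -/
def betaTilde (γ : ℝ) (m : ℕ) (s : Set ℝ) (h u : ℝ → ℝ) (r : ℝ) : ℝ :=
  h r ^ weightExp γ *
    (derivWithin u s r - 2 / (γ - 1) * derivWithin h s r
      - m * h r * u r / (r * (u r - h r)))

/-- The region `{(r, t) | 0 ≤ t < τ, b₁(t) ≤ r ≤ b₂(t)}` of space-time. -/
def region (b₁ b₂ : ℝ → ℝ) (τ : ℝ) : Set (ℝ × ℝ) :=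
  {p | p.2 ∈ Ico 0 τ ∧ p.1 ∈ Icc (b₁ p.2) (b₂ p.2)}

/-- `(ρ, u)` is a smooth (twice continuously differentiable) solution, with positive density, of
the radially symmetric isentropic Euler equations
`(r^m ρ)_t + (r^m ρ u)_r = 0`, `(r^m ρ u)_t + (r^m ρ u²)_r + r^m p_r = 0`, `p = K ρ^γ`,
for times in `[0, τ)`, on the region between the 2-characteristic `b₁` issuing from `r₁` and the
1-characteristic `b₂` issuing from `r₂`, and its initial sound speed and velocity on `[r₁, r₂]` are
`h₀` and `u₀`. The equations are imposed in the interior of the region; by continuity of the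
derivatives they hold up to the boundary. -/
structure IsSmoothSolution (K γ : ℝ) (m : ℕ) (r₁ r₂ : ℝ) (h₀ u₀ : ℝ → ℝ) (τ : ℝ)
    (ρ u : ℝ → ℝ → ℝ) (b₁ b₂ : ℝ → ℝ) : Prop where
  left_init : b₁ 0 = r₁
  right_init : b₂ 0 = r₂
  left_char : ∀ t ∈ Ico 0 τ,
    HasDerivWithinAt b₁ (u (b₁ t) t + soundSpeed K γ (ρ (b₁ t) t)) (Ico 0 τ) t
  right_char : ∀ t ∈ Ico 0 τ,
    HasDerivWithinAt b₂ (u (b₂ t) t - soundSpeed K γ (ρ (b₂ t) t)) (Ico 0 τ) t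
  smooth_density : ContDiffOn ℝ 2 (fun p : ℝ × ℝ => ρ p.1 p.2) (region b₁ b₂ τ)
  smooth_velocity : ContDiffOn ℝ 2 (fun p : ℝ × ℝ => u p.1 p.2) (region b₁ b₂ τ)
  density_pos : ∀ p ∈ region b₁ b₂ τ, 0 < ρ p.1 p.2
  mass : ∀ t ∈ Ioo 0 τ, ∀ r ∈ Ioo (b₁ t) (b₂ t),
    deriv (fun s => r ^ m * ρ r s) t + deriv (fun x => x ^ m * ρ x t * u x t) r = 0
  momentum : ∀ t ∈ Ioo 0 τ, ∀ r ∈ Ioo (b₁ t) (b₂ t),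
    deriv (fun s => r ^ m * ρ r s * u r s) t
      + deriv (fun x => x ^ m * ρ x t * u x t ^ 2) r
      + r ^ m * deriv (fun x => K * ρ x t ^ γ) r = 0
  init_soundSpeed : ∀ r ∈ Icc r₁ r₂, soundSpeed K γ (ρ r 0) = h₀ r
  init_velocity : ∀ r ∈ Icc r₁ r₂, u r 0 = u₀ r

/-- The constant `α^* = (hHi / hLo)^((γ+1)/(2(γ-1))) αHi`. -/
def alphaUp (γ hLo hHi αHi : ℝ) : ℝ := (hHi / hLo) ^ ((γ + 1) / (2 * (γ - 1))) * αHi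

/-- The time
`T̃ = min {(r₁ - r₀)/(uLo + 2 hHi), (2/((γ-1) α^*)) hLo^((γ-3)/(2(γ-1)))}`. -/
def maxTime (γ r₀ r₁ hLo hHi uLo αHi : ℝ) : ℝ :=
  min ((r₁ - r₀) / (uLo + 2 * hHi))
    (2 / ((γ - 1) * alphaUp γ hLo hHi αHi) * hLo ^ weightExp γ)

/-- `N(T, r_*) = max {βLo hHi^(-(γ-3)/(2(γ-1))), 1/T, (uLo + 2 hHi)/(r_* - r₁)}`. -/
def threshold (γ r₁ hHi uLo βLo T rs : ℝ) : ℝ :=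
  max (βLo * hHi ^ (-weightExp γ)) (max (1 / T) ((uLo + 2 * hHi) / (rs - r₁)))

end

end RadialEuler

/-! Write E = ∂ᵣ(u + 2h/(γ-1)) + m u/r (`decayRate`), β = h^(-κ) β̃ (`betaPlain`) and κ = `weightExp
γ`. Along a 1-characteristic β̃ satisfies a Riccati equation: the square term has coefficient
(γ+1)/4 ≥ 1, and the weight h^κ removes the product of β with E. While u < -2h, E ≥ 0 and β < 0,
every other term has the damping sign. Hence β̃' < -h^(-κ) β̃² ≤ -hHi^(-κ) β̃² as long as h < hHi,
and 1/β̃, which is negative, would rise to 0 no later than time 1/N.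

The work is to keep these signs, and the five inequalities of `IsCompressed` sustain each other. E >
0 makes h and u decrease along 1-characteristics. The sign u < 0 makes u + 2h/(γ-1) increase along
2-characteristics, which keeps u above -(uLo + hHi). The Riccati inequality makes β̃ decrease along
1-characteristics. Finally, at a zero of E its derivative along the 2-characteristic is positive
provided β r ≤ 8 m u (`decay_source_pos`), and the lower bound on βLo guarantees that.

The propagation is a maximum principle (`HasPartialsWithinAt.directional_nonpos`), without following
individual characteristics: at an earliest failure the gap in the failing inequality has a
nonpositive derivative in the characteristic direction, against the strict sign of its source. It
works up to the lateral boundary because characteristics traced backward do not leave the region.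

Characteristic speeds are at least -(uLo + 2hHi). Up to σ = min τ (1/N) this keeps the region from
closing, keeps b₁ above r₀, and keeps the 1-characteristic from rs off b₁. The Riccati estimate then
forces σ < 1/N, that is σ = τ. -/

namespace RadialEuler

/-! ### Calculus of partial derivatives within a set. -/

/-- `f` has the partial derivatives `a` (in `r`) and `b` (in `t`) at `p`, within `S`, in the sense
of Fréchet. -/
def HasPartialsWithinAt (f : ℝ × ℝ → ℝ) (a b : ℝ) (S : Set (ℝ × ℝ)) (p : ℝ × ℝ) : Prop :=
  HasFDerivWithinAt f (a • ContinuousLinearMap.fst ℝ ℝ ℝ + b • ContinuousLinearMap.snd ℝ ℝ ℝ) S p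

/-- The partial derivative in `r` within `S`. -/
noncomputable def dr (S : Set (ℝ × ℝ)) (f : ℝ × ℝ → ℝ) (p : ℝ × ℝ) : ℝ :=
  fderivWithin ℝ f S p (1, 0)

/-- The partial derivative in `t` within `S`. -/
noncomputable def dt (S : Set (ℝ × ℝ)) (f : ℝ × ℝ → ℝ) (p : ℝ × ℝ) : ℝ :=
  fderivWithin ℝ f S p (0, 1)

namespace HasPartialsWithinAt

variable {f g : ℝ × ℝ → ℝ} {a b a' b' : ℝ} {S : Set (ℝ × ℝ)} {p : ℝ × ℝ}

theorem congr_val (hf : HasPartialsWithinAt f a b S p) (ha : a = a') (hb : b = b') :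
    HasPartialsWithinAt f a' b' S p := ha ▸ hb ▸ hf

theorem continuousWithinAt (hf : HasPartialsWithinAt f a b S p) : ContinuousWithinAt f S p :=
  HasFDerivWithinAt.continuousWithinAt hf

theorem of_differentiableWithinAt (hf : DifferentiableWithinAt ℝ f S p) :
    HasPartialsWithinAt f (dr S f p) (dt S f p) S p := by
  have h := hf.hasFDerivWithinAt
  unfold HasPartialsWithinAt
  convert! h using 1
  ext <;> simp [dr, dt]

theorem unique (hS : UniqueDiffWithinAt ℝ S p) (hf : HasPartialsWithinAt f a b S p)
    (hg : HasPartialsWithinAt f a' b' S p) : a = a' ∧ b = b' := by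
  have h := hS.eq hf hg
  have h1 := DFunLike.congr_fun h (1, 0)
  have h2 := DFunLike.congr_fun h (0, 1)
  simp at h1 h2
  exact ⟨h1, h2⟩

theorem congr (hf : HasPartialsWithinAt f a b S p) (hfg : ∀ q ∈ S, g q = f q) (hp : p ∈ S) :
    HasPartialsWithinAt g a b S p :=
  HasFDerivWithinAt.congr hf hfg (hfg p hp)

theorem const (c : ℝ) : HasPartialsWithinAt (fun _ => c) 0 0 S p := by
  unfold HasPartialsWithinAt
  simpa using! hasFDerivWithinAt_const c p S

theorem fst : HasPartialsWithinAt (fun q => q.1) 1 0 S p := by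
  unfold HasPartialsWithinAt
  simpa using! hasFDerivWithinAt_fst (𝕜 := ℝ) (p := p) (s := S)

theorem add (hf : HasPartialsWithinAt f a b S p) (hg : HasPartialsWithinAt g a' b' S p) :
    HasPartialsWithinAt (fun q => f q + g q) (a + a') (b + b') S p := by
  unfold HasPartialsWithinAt at *
  convert! HasFDerivWithinAt.add hf hg using 1
  module

theorem neg (hf : HasPartialsWithinAt f a b S p) :
    HasPartialsWithinAt (fun q => -f q) (-a) (-b) S p := by
  unfold HasPartialsWithinAt at *
  convert! HasFDerivWithinAt.neg hf using 1
  module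

theorem sub (hf : HasPartialsWithinAt f a b S p) (hg : HasPartialsWithinAt g a' b' S p) :
    HasPartialsWithinAt (fun q => f q - g q) (a - a') (b - b') S p := by
  unfold HasPartialsWithinAt at *
  convert! HasFDerivWithinAt.sub hf hg using 1
  module

theorem mul (hf : HasPartialsWithinAt f a b S p) (hg : HasPartialsWithinAt g a' b' S p) :
    HasPartialsWithinAt (fun q => f q * g q) (a * g p + f p * a') (b * g p + f p * b') S p := by
  unfold HasPartialsWithinAt at *
  convert! HasFDerivWithinAt.mul hf hg using 1
  module

theorem const_mul (c : ℝ) (hf : HasPartialsWithinAt f a b S p) :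
    HasPartialsWithinAt (fun q => c * f q) (c * a) (c * b) S p :=
  ((const c).mul hf).congr_val (by ring) (by ring)

theorem comp_hasDerivAt {φ : ℝ → ℝ} {d : ℝ} (hf : HasPartialsWithinAt f a b S p)
    (hφ : HasDerivAt φ d (f p)) :
    HasPartialsWithinAt (fun q => φ (f q)) (d * a) (d * b) S p := by
  unfold HasPartialsWithinAt at *
  convert! hφ.comp_hasFDerivWithinAt p hf using 1
  module

theorem div (hf : HasPartialsWithinAt f a b S p) (hg : HasPartialsWithinAt g a' b' S p)
    (h0 : g p ≠ 0) :
    HasPartialsWithinAt (fun q => f q / g q) ((a * g p - f p * a') / g p ^ 2)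
      ((b * g p - f p * b') / g p ^ 2) S p := by
  have h := hf.mul (hg.comp_hasDerivAt (hasDerivAt_inv h0))
  refine (h.congr_val ?_ ?_) <;> field_simp <;> ring

theorem rpow_const (e : ℝ) (hf : HasPartialsWithinAt f a b S p) (h0 : 0 < f p) :
    HasPartialsWithinAt (fun q => f q ^ e) (e * f p ^ e / f p * a) (e * f p ^ e / f p * b) S p := by
  have h := hf.comp_hasDerivAt (Real.hasDerivAt_rpow_const (p := e) (Or.inl h0.ne'))
  refine h.congr_val ?_ ?_ <;> rw [Real.rpow_sub_one h0.ne'] <;> ring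

theorem comp_curve {X : ℝ → ℝ} {v t : ℝ} {I : Set ℝ} (hf : HasPartialsWithinAt f a b S (X t, t))
    (hX : HasDerivWithinAt X v I t) (hI : ∀ s ∈ I, (X s, s) ∈ S) :
    HasDerivWithinAt (fun s => f (X s, s)) (v * a + b) I t := by
  have h1 : HasDerivWithinAt (fun s => (X s, s)) (v, (1 : ℝ)) I t :=
    hX.prodMk (hasDerivWithinAt_id t I)
  have h2 := HasFDerivWithinAt.comp_hasDerivWithinAt (f := fun s => (X s, s)) t hf h1 hI
  convert! h2 using 1
  simp
  ring

theorem slice {r t : ℝ} {I : Set ℝ} (hf : HasPartialsWithinAt f a b S (r, t))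
    (hI : ∀ x ∈ I, (x, t) ∈ S) : HasDerivWithinAt (fun x => f (x, t)) a I r := by
  have h1 : HasDerivWithinAt (fun x => (x, t)) ((1 : ℝ), (0 : ℝ)) I r :=
    (hasDerivWithinAt_id r I).prodMk (hasDerivWithinAt_const r I t)
  have h2 := HasFDerivWithinAt.comp_hasDerivWithinAt (f := fun x => (x, t)) r hf h1 hI
  convert! h2 using 1
  simp

end HasPartialsWithinAt

/-! ### Second derivatives up to the boundary. -/

section SecondOrder

variable {f : ℝ × ℝ → ℝ} {S : Set (ℝ × ℝ)}

theorem hasPartialsWithinAt_of_contDiffOn (hf : ContDiffOn ℝ 2 f S) {p : ℝ × ℝ} (hp : p ∈ S) :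
    HasPartialsWithinAt f (dr S f p) (dt S f p) S p :=
  .of_differentiableWithinAt ((hf.differentiableOn (by norm_num)) p hp)

theorem contDiffOn_dr (hS : UniqueDiffOn ℝ S) (hf : ContDiffOn ℝ 2 f S) :
    ContDiffOn ℝ 1 (dr S f) S :=
  (hf.fderivWithin hS (by norm_num)).clm_apply contDiffOn_const

theorem contDiffOn_dt (hS : UniqueDiffOn ℝ S) (hf : ContDiffOn ℝ 2 f S) :
    ContDiffOn ℝ 1 (dt S f) S :=
  (hf.fderivWithin hS (by norm_num)).clm_apply contDiffOn_const

theorem hasPartialsWithinAt_dr (hS : UniqueDiffOn ℝ S) (hf : ContDiffOn ℝ 2 f S) {p : ℝ × ℝ}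
    (hp : p ∈ S) : HasPartialsWithinAt (dr S f) (dr S (dr S f) p) (dt S (dr S f) p) S p :=
  .of_differentiableWithinAt (((contDiffOn_dr hS hf).differentiableOn (by norm_num)) p hp)

/-- Symmetry of the second derivative extends to boundary points because they are limits of interior
points. -/
theorem dr_dt_eq_dt_dr (hS : UniqueDiffOn ℝ S) (hS' : S ⊆ closure (interior S))
    (hf : ContDiffOn ℝ 2 f S) {p : ℝ × ℝ} (hp : p ∈ S) :
    dr S (dt S f) p = dt S (dr S f) p := by
  have hd : DifferentiableWithinAt ℝ (fderivWithin ℝ f S) S p :=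
    ((hf.fderivWithin (m := 1) hS (by norm_num)).differentiableOn (by norm_num)) p hp
  have key : ∀ v w : ℝ × ℝ, fderivWithin ℝ (fun q => fderivWithin ℝ f S q v) S p w
      = fderivWithin ℝ (fderivWithin ℝ f S) S p w v := by
    intro v w
    rw [fderivWithin_clm_apply (hS p hp) hd (differentiableWithinAt_const v)]
    simp
  have hsymm := (hf p hp).isSymmSndFDerivWithinAt (by simp) hS (hS' hp) hp
  have h1 := key (0, 1) (1, 0)
  have h2 := key (1, 0) (0, 1)
  change fderivWithin ℝ (fun q => fderivWithin ℝ f S q (0, 1)) S p (1, 0)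
    = fderivWithin ℝ (fun q => fderivWithin ℝ f S q (1, 0)) S p (0, 1)
  rw [h1, h2]
  exact hsymm.eq _ _

theorem hasPartialsWithinAt_dt (hS : UniqueDiffOn ℝ S) (hS' : S ⊆ closure (interior S))
    (hf : ContDiffOn ℝ 2 f S) {p : ℝ × ℝ} (hp : p ∈ S) :
    HasPartialsWithinAt (dt S f) (dt S (dr S f) p) (dt S (dt S f) p) S p := by
  have h := HasPartialsWithinAt.of_differentiableWithinAt
    (((contDiffOn_dt hS hf).differentiableOn (by norm_num)) p hp)
  exact h.congr_val (dr_dt_eq_dt_dr hS hS' hf hp) rfl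

end SecondOrder

/-! ### Geometry of the region and the maximum principle on it. -/

section Geometry

open Filter Topology

variable {b₁ b₂ : ℝ → ℝ} {σ : ℝ}

/-- The map `(θ, t) ↦ ((1 - θ) b₁(t) + θ b₂(t), t)` parametrizing `region b₁ b₂ σ`. -/
def interp (b₁ b₂ : ℝ → ℝ) (q : ℝ × ℝ) : ℝ × ℝ := (b₁ q.2 + q.1 * (b₂ q.2 - b₁ q.2), q.2)

theorem interp_mem_region (hlt : ∀ t ∈ Ico 0 σ, b₁ t < b₂ t) {θ t : ℝ} (hθ : θ ∈ Icc (0 : ℝ) 1)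
    (ht : t ∈ Ico 0 σ) : interp b₁ b₂ (θ, t) ∈ region b₁ b₂ σ := by
  have := hlt t ht
  refine ⟨ht, ?_, ?_⟩ <;> simp only [interp] <;> nlinarith [hθ.1, hθ.2]

theorem exists_interp_eq (hlt : ∀ t ∈ Ico 0 σ, b₁ t < b₂ t) {p : ℝ × ℝ}
    (hp : p ∈ region b₁ b₂ σ) : ∃ θ ∈ Icc (0 : ℝ) 1, interp b₁ b₂ (θ, p.2) = p := by
  have h := sub_pos.2 (hlt p.2 hp.1)
  refine ⟨(p.1 - b₁ p.2) / (b₂ p.2 - b₁ p.2),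
    ⟨div_nonneg (by linarith [hp.2.1]) h.le, (div_le_one h).2 (by linarith [hp.2.2])⟩, ?_⟩
  ext <;> simp only [interp]
  rw [div_mul_cancel₀ _ h.ne']
  ring

theorem region_eq_image (hlt : ∀ t ∈ Ico 0 σ, b₁ t < b₂ t) :
    region b₁ b₂ σ = interp b₁ b₂ '' (Icc 0 1 ×ˢ Ico 0 σ) := by
  ext p
  constructor
  · intro hp
    obtain ⟨θ, hθ, h⟩ := exists_interp_eq hlt hp
    exact ⟨(θ, p.2), ⟨hθ, hp.1⟩, h⟩
  · rintro ⟨⟨θ, t⟩, ⟨hθ, ht⟩, rfl⟩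
    exact interp_mem_region hlt hθ ht

/-- A rectangle has unique derivatives, and the derivative of `interp` is onto because b₁ < b₂, so
the image inherits the property. -/
theorem uniqueDiffOn_region (hlt : ∀ t ∈ Ico 0 σ, b₁ t < b₂ t)
    (hb₁ : DifferentiableOn ℝ b₁ (Ico 0 σ)) (hb₂ : DifferentiableOn ℝ b₂ (Ico 0 σ)) :
    UniqueDiffOn ℝ (region b₁ b₂ σ) := by
  rw [region_eq_image hlt]
  rintro _ ⟨⟨θ, t⟩, ⟨hθ, ht⟩, rfl⟩
  have hU : UniqueDiffWithinAt ℝ (Icc (0 : ℝ) 1 ×ˢ Ico 0 σ) (θ, t) :=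
    (uniqueDiffOn_Icc_zero_one θ hθ).prod (uniqueDiffOn_Ico 0 σ t ht)
  have hsnd : HasFDerivWithinAt (fun q : ℝ × ℝ => q.2) (ContinuousLinearMap.snd ℝ ℝ ℝ)
      (Icc (0 : ℝ) 1 ×ˢ Ico 0 σ) (θ, t) := hasFDerivWithinAt_snd
  have hfst : HasFDerivWithinAt (fun q : ℝ × ℝ => q.1) (ContinuousLinearMap.fst ℝ ℝ ℝ)
      (Icc (0 : ℝ) 1 ×ˢ Ico 0 σ) (θ, t) := hasFDerivWithinAt_fst
  have h1 := (hb₁ t ht).hasDerivWithinAt.comp_hasFDerivWithinAt (f := fun q : ℝ × ℝ => q.2)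
    (θ, t) hsnd (fun q hq => hq.2)
  have h2 := (hb₂ t ht).hasDerivWithinAt.comp_hasFDerivWithinAt (f := fun q : ℝ × ℝ => q.2)
    (θ, t) hsnd (fun q hq => hq.2)
  have h3 : HasFDerivWithinAt (interp b₁ b₂) _ (Icc (0 : ℝ) 1 ×ˢ Ico 0 σ) (θ, t) :=
    (h1.add (hfst.mul (h2.sub h1))).prodMk hsnd
  refine h3.uniqueDiffWithinAt hU (Function.Surjective.denseRange ?_)
  rintro ⟨x, y⟩
  have hne := (sub_pos.2 (hlt t ht)).ne'
  refine ⟨((x - (derivWithin b₁ (Ico 0 σ) t + θ * (derivWithin b₂ (Ico 0 σ) t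
    - derivWithin b₁ (Ico 0 σ) t)) * y) / (b₂ t - b₁ t), y), ?_⟩
  ext
  · simp
    field_simp
    ring
  · simp

theorem isOpen_interior_region (hb₁ : ContinuousOn b₁ (Ico 0 σ)) (hb₂ : ContinuousOn b₂ (Ico 0 σ)) :
    IsOpen {p : ℝ × ℝ | p.2 ∈ Ioo 0 σ ∧ p.1 ∈ Ioo (b₁ p.2) (b₂ p.2)} := by
  rw [isOpen_iff_mem_nhds]
  rintro ⟨r, t⟩ ⟨ht, hr⟩
  have hc₁ : ContinuousAt (fun p : ℝ × ℝ => b₁ p.2) (r, t) :=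
    ContinuousAt.comp (f := fun p : ℝ × ℝ => p.2)
      (hb₁.continuousAt (mem_nhds_iff.2 ⟨Ioo 0 σ, Ioo_subset_Ico_self, isOpen_Ioo, ht⟩))
      continuousAt_snd
  have hc₂ : ContinuousAt (fun p : ℝ × ℝ => b₂ p.2) (r, t) :=
    ContinuousAt.comp (f := fun p : ℝ × ℝ => p.2)
      (hb₂.continuousAt (mem_nhds_iff.2 ⟨Ioo 0 σ, Ioo_subset_Ico_self, isOpen_Ioo, ht⟩))
      continuousAt_snd
  filter_upwards [continuousAt_snd.eventually (isOpen_Ioo.mem_nhds ht),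
    hc₁.eventually_lt continuousAt_fst hr.1, ContinuousAt.eventually_lt continuousAt_fst hc₂ hr.2]
    with p h1 h2 h3
  exact ⟨h1, h2, h3⟩

theorem interior_subset_region :
    {p : ℝ × ℝ | p.2 ∈ Ioo 0 σ ∧ p.1 ∈ Ioo (b₁ p.2) (b₂ p.2)} ⊆ region b₁ b₂ σ :=
  fun _ hp => ⟨Ioo_subset_Ico_self hp.1, Ioo_subset_Icc_self hp.2⟩

theorem region_subset_closure (hlt : ∀ t ∈ Ico 0 σ, b₁ t < b₂ t)
    (hb₁ : ContinuousOn b₁ (Ico 0 σ)) (hb₂ : ContinuousOn b₂ (Ico 0 σ)) :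
    region b₁ b₂ σ ⊆ closure {p : ℝ × ℝ | p.2 ∈ Ioo 0 σ ∧ p.1 ∈ Ioo (b₁ p.2) (b₂ p.2)} := by
  rw [region_eq_image hlt]
  rintro _ ⟨⟨θ, t⟩, ⟨hθ, ht⟩, rfl⟩
  have hσ : (0 : ℝ) ≠ σ := (ht.1.trans_lt ht.2).ne
  have hmem : (θ, t) ∈ closure (Ioo (0 : ℝ) 1 ×ˢ Ioo 0 σ) := by
    rw [closure_prod_eq, closure_Ioo zero_ne_one, closure_Ioo hσ]
    exact ⟨hθ, Ico_subset_Icc_self ht⟩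
  have hc : ContinuousWithinAt (interp b₁ b₂) (Ioo (0 : ℝ) 1 ×ˢ Ioo 0 σ) (θ, t) := by
    have h1 : ContinuousWithinAt (fun q : ℝ × ℝ => b₁ q.2) (Ioo (0 : ℝ) 1 ×ˢ Ioo 0 σ) (θ, t) :=
      ContinuousWithinAt.comp (f := fun q : ℝ × ℝ => q.2) (hb₁ t ht)
        continuous_snd.continuousWithinAt (fun q hq => Ioo_subset_Ico_self hq.2)
    have h2 : ContinuousWithinAt (fun q : ℝ × ℝ => b₂ q.2) (Ioo (0 : ℝ) 1 ×ˢ Ioo 0 σ) (θ, t) :=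
      ContinuousWithinAt.comp (f := fun q : ℝ × ℝ => q.2) (hb₂ t ht)
        continuous_snd.continuousWithinAt (fun q hq => Ioo_subset_Ico_self hq.2)
    exact (h1.add (continuous_fst.continuousWithinAt.mul (h2.sub h1))).prodMk
      continuous_snd.continuousWithinAt
  refine closure_mono ?_ (hc.mem_closure_image hmem)
  rintro _ ⟨⟨η, s⟩, ⟨hη, hs⟩, rfl⟩
  have := hlt s (Ioo_subset_Ico_self hs)
  refine ⟨hs, ?_, ?_⟩ <;> simp only [interp] <;> nlinarith [hη.1, hη.2]

theorem region_subset_closure_interior (hlt : ∀ t ∈ Ico 0 σ, b₁ t < b₂ t)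
    (hb₁ : ContinuousOn b₁ (Ico 0 σ)) (hb₂ : ContinuousOn b₂ (Ico 0 σ)) :
    region b₁ b₂ σ ⊆ closure (interior (region b₁ b₂ σ)) :=
  (region_subset_closure hlt hb₁ hb₂).trans
    (closure_mono (interior_maximal interior_subset_region (isOpen_interior_region hb₁ hb₂)))

theorem isCompact_region_le (hlt : ∀ t ∈ Ico 0 σ, b₁ t < b₂ t)
    (hb₁ : ContinuousOn b₁ (Ico 0 σ)) (hb₂ : ContinuousOn b₂ (Ico 0 σ)) {t : ℝ} (ht : t < σ) :
    IsCompact {p ∈ region b₁ b₂ σ | p.2 ≤ t} := by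
  have himg : {p ∈ region b₁ b₂ σ | p.2 ≤ t} = interp b₁ b₂ '' (Icc 0 1 ×ˢ Icc 0 t) := by
    ext p
    constructor
    · rintro ⟨hp, hpt⟩
      obtain ⟨θ, hθ, h⟩ := exists_interp_eq hlt hp
      exact ⟨(θ, p.2), ⟨hθ, hp.1.1, hpt⟩, h⟩
    · rintro ⟨⟨θ, s⟩, ⟨hθ, hs⟩, rfl⟩
      exact ⟨interp_mem_region hlt hθ ⟨hs.1, hs.2.trans_lt ht⟩, hs.2⟩
  rw [himg]
  refine (isCompact_Icc.prod isCompact_Icc).image_of_continuousOn ?_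
  have hm : MapsTo (fun q : ℝ × ℝ => q.2) (Icc (0 : ℝ) 1 ×ˢ Icc 0 t) (Ico 0 σ) :=
    fun q hq => ⟨hq.2.1, hq.2.2.trans_lt ht⟩
  have h1 := hb₁.comp continuous_snd.continuousOn hm
  have h2 := hb₂.comp continuous_snd.continuousOn hm
  exact (h1.add (continuous_fst.continuousOn.mul (h2.sub h1))).prodMk continuous_snd.continuousOn

/-- Continuous induction in time over a region: a relatively open property that holds initially
and passes from all earlier points to the present holds everywhere. -/
theorem forall_mem_region_of_forall_earlier (hlt : ∀ t ∈ Ico 0 σ, b₁ t < b₂ t)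
    (hb₁ : ContinuousOn b₁ (Ico 0 σ)) (hb₂ : ContinuousOn b₂ (Ico 0 σ)) {good : ℝ × ℝ → Prop}
    (hopen : ∀ p ∈ region b₁ b₂ σ, good p → ∀ᶠ q in 𝓝[region b₁ b₂ σ] p, good q)
    (hinit : ∀ p ∈ region b₁ b₂ σ, p.2 = 0 → good p)
    (hstep : ∀ p ∈ region b₁ b₂ σ, 0 < p.2 →
      (∀ q ∈ region b₁ b₂ σ, q.2 < p.2 → good q) → good p) :
    ∀ p ∈ region b₁ b₂ σ, good p := by
  by_contra! hcon
  obtain ⟨p₀, hp₀, hbad⟩ := hcon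
  set K := {p ∈ region b₁ b₂ σ | p.2 ≤ p₀.2} with hK
  have hKc : IsCompact K := isCompact_region_le hlt hb₁ hb₂ hp₀.1.2
  -- Relative openness makes O an open set of the plane meeting the region exactly in its good
  -- points; the bad points up to the time of p₀ are then compact and one of them is earliest.
  set O := interior ({p | good p} ∪ (region b₁ b₂ σ)ᶜ) with hO
  have hgoodO : ∀ p ∈ region b₁ b₂ σ, good p → p ∈ O := by
    intro p hp hg
    rw [hO, mem_interior_iff_mem_nhds]
    filter_upwards [eventually_nhdsWithin_iff.1 (hopen p hp hg)] with q hq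
    by_cases hqS : q ∈ region b₁ b₂ σ
    · exact Or.inl (hq hqS)
    · exact Or.inr hqS
  have hOgood : ∀ p ∈ region b₁ b₂ σ, p ∈ O → good p := by
    intro p hp hpO
    rcases interior_subset hpO with h | h
    · exact h
    · exact absurd hp h
  have hcomp : IsCompact (K \ O) := hKc.diff isOpen_interior
  obtain ⟨p, hp, hmin⟩ := hcomp.exists_isMinOn
    ⟨p₀, ⟨hp₀, le_refl p₀.2⟩, fun h => hbad (hOgood p₀ hp₀ h)⟩
    (continuous_snd (X := ℝ) (Y := ℝ)).continuousOn
  refine hp.2 (hgoodO p hp.1.1 ?_)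
  rcases hp.1.1.1.1.eq_or_lt with h0 | h0
  · exact hinit p hp.1.1 h0.symm
  · refine hstep p hp.1.1 h0 fun q hq hqt => ?_
    by_contra hqb
    have := hmin (a := q) ⟨⟨hq, hqt.le.trans hp.1.2⟩, fun h => hqb (hOgood q hq h)⟩
    simp only [mem_ofPred_eq] at this
    linarith

/-- A point of the region at a positive time is a limit of earlier points of the region. -/
theorem nonneg_of_forall_earlier_pos (hlt : ∀ t ∈ Ico 0 σ, b₁ t < b₂ t)
    (hb₁ : ContinuousOn b₁ (Ico 0 σ)) (hb₂ : ContinuousOn b₂ (Ico 0 σ)) {G : ℝ × ℝ → ℝ} {p : ℝ × ℝ}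
    (hp : p ∈ region b₁ b₂ σ) (h0 : 0 < p.2) (hG : ContinuousWithinAt G (region b₁ b₂ σ) p)
    (hpos : ∀ q ∈ region b₁ b₂ σ, q.2 < p.2 → 0 < G q) : 0 ≤ G p := by
  obtain ⟨θ, hθ, hpθ⟩ := exists_interp_eq hlt hp
  have hsub : Ioo 0 p.2 ⊆ Ico 0 σ := fun s hs => ⟨hs.1.le, hs.2.trans hp.1.2⟩
  have hc : ContinuousWithinAt (fun s => interp b₁ b₂ (θ, s)) (Ioo 0 p.2) p.2 := by
    have h1 := (hb₁ p.2 hp.1).mono hsub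
    have h2 := (hb₂ p.2 hp.1).mono hsub
    exact (h1.add (continuousWithinAt_const.mul (h2.sub h1))).prodMk continuousWithinAt_id
  have hc' : ContinuousWithinAt (fun s => G (interp b₁ b₂ (θ, s))) (Ioo 0 p.2) p.2 := by
    refine ContinuousWithinAt.comp (t := region b₁ b₂ σ) (by rwa [hpθ]) hc fun s hs => ?_
    exact interp_mem_region hlt hθ (hsub hs)
  have hne : (𝓝[Ioo 0 p.2] p.2).NeBot := by
    rw [← mem_closure_iff_nhdsWithin_neBot, closure_Ioo h0.ne]
    exact ⟨h0.le, le_refl _⟩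
  have hlim : 0 ≤ G (interp b₁ b₂ (θ, p.2)) := by
    refine ge_of_tendsto hc' ?_
    filter_upwards [self_mem_nhdsWithin] with s hs
    exact (hpos _ (interp_mem_region hlt hθ (hsub hs)) hs.2).le
  rwa [hpθ] at hlim

theorem deriv_nonpos_of_past_nonneg {g : ℝ → ℝ} {d T : ℝ} {I : Set ℝ} (h0 : 0 < T)
    (hI : Icc 0 T ⊆ I) (hg : HasDerivWithinAt g d I T) (hnn : ∀ s ∈ Icc 0 T, 0 ≤ g s)
    (hz : g T ≤ 0) : d ≤ 0 := by
  have hmin : IsLocalMinOn g (Icc 0 T) T :=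
    IsMinOn.localize fun s hs => hz.trans (hnn s hs)
  have := hmin.hasFDerivWithinAt_nonneg (hg.mono hI).hasFDerivWithinAt
    (sub_mem_posTangentConeAt_of_segment_subset (y := 0)
      ((convex_Icc 0 T).segment_subset ⟨h0.le, le_refl T⟩ ⟨le_refl 0, h0.le⟩))
  simp at this
  nlinarith

/-- At a first zero of G, minimality in space gives a = 0 inside, a ≥ 0 on the left edge and a ≤ 0
on the right edge, while minimality over the past bounds the derivative along one curve in the
region. The speed conditions say that the direction (v, 1), traced backward, does not leave the
region; they give the correction from that curve to speed v the right sign. -/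
theorem HasPartialsWithinAt.directional_nonpos (hlt : ∀ t ∈ Ico 0 σ, b₁ t < b₂ t) {G : ℝ × ℝ → ℝ}
    {r t a b v v₁ v₂ : ℝ} (hp : (r, t) ∈ region b₁ b₂ σ) (h0 : 0 < t)
    (hb₁ : HasDerivWithinAt b₁ v₁ (Ico 0 σ) t) (hb₂ : HasDerivWithinAt b₂ v₂ (Ico 0 σ) t)
    (hG : HasPartialsWithinAt G a b (region b₁ b₂ σ) (r, t))
    (hnn : ∀ q ∈ region b₁ b₂ σ, q.2 ≤ t → 0 ≤ G q) (hz : G (r, t) ≤ 0)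
    (hv₁ : r = b₁ t → v ≤ v₁) (hv₂ : r = b₂ t → v₂ ≤ v) : v * a + b ≤ 0 := by
  have ht := hp.1
  have hlt' := hlt t ht
  have hslice : ∀ x ∈ Icc (b₁ t) (b₂ t), (x, t) ∈ region b₁ b₂ σ := fun x hx => ⟨ht, hx⟩
  have hr : r ∈ Icc (b₁ t) (b₂ t) := hp.2
  have hmin : IsLocalMinOn (fun x => G (x, t)) (Icc (b₁ t) (b₂ t)) r :=
    IsMinOn.localize fun x hx => hz.trans (hnn _ (hslice x hx) le_rfl)
  have hder := (hG.slice hslice).hasFDerivWithinAt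
  have hright : 0 ≤ (b₂ t - r) * a := by
    have := hmin.hasFDerivWithinAt_nonneg hder
      (sub_mem_posTangentConeAt_of_segment_subset (y := b₂ t)
        ((convex_Icc _ _).segment_subset hr ⟨hlt'.le, le_rfl⟩))
    simpa using this
  have hleft : 0 ≤ (b₁ t - r) * a := by
    have := hmin.hasFDerivWithinAt_nonneg hder
      (sub_mem_posTangentConeAt_of_segment_subset (y := b₁ t)
        ((convex_Icc _ _).segment_subset hr ⟨le_rfl, hlt'.le⟩))
    simpa using this
  -- The comparison curve keeps a fixed proportion θ between the two boundaries, so its whole past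
  -- lies in the region.
  obtain ⟨θ, hθ, hpθ⟩ := exists_interp_eq hlt hp
  simp only [interp, Prod.mk.injEq, and_true] at hpθ
  have hX : HasDerivWithinAt (fun s => b₁ s + θ * (b₂ s - b₁ s)) (v₁ + θ * (v₂ - v₁)) (Ico 0 σ) t :=
    hb₁.add ((hb₂.sub hb₁).const_mul θ)
  have hG' : HasPartialsWithinAt G a b (region b₁ b₂ σ)
      ((fun s => b₁ s + θ * (b₂ s - b₁ s)) t, t) := by simpa only [hpθ] using hG
  have hcurve := hG'.comp_curve hX fun s hs => interp_mem_region hlt hθ hs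
  have hsub : Icc 0 t ⊆ Ico 0 σ := fun s hs => ⟨hs.1, hs.2.trans_lt ht.2⟩
  have hle := deriv_nonpos_of_past_nonneg h0 hsub hcurve
    (fun s hs => hnn _ (interp_mem_region hlt hθ (hsub hs)) hs.2) (by simpa only [hpθ] using hz)
  rcases hr.1.eq_or_lt with h1 | h1
  · have hθ0 : θ = 0 := by
      have : θ * (b₂ t - b₁ t) = 0 := by linarith
      exact (mul_eq_zero.1 this).resolve_right (by linarith)
    have := hv₁ h1.symm
    have ha : 0 ≤ a := by
      rw [← h1] at hright
      exact nonneg_of_mul_nonneg_right hright (by linarith)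
    subst hθ0
    nlinarith
  · have ha : a ≤ 0 := by
      by_contra! h
      nlinarith
    rcases hr.2.eq_or_lt with h2 | h2
    · have hθ1 : θ = 1 := by
        have : (θ - 1) * (b₂ t - b₁ t) = 0 := by linarith
        have := (mul_eq_zero.1 this).resolve_right (by linarith)
        linarith
      have := hv₂ h2
      subst hθ1
      nlinarith
    · have ha0 : a = 0 := by
        refine le_antisymm ha ?_
        by_contra! h
        nlinarith
      rw [ha0] at hle ⊢
      linarith

end Geometry

/-! ### Transport identities along characteristics. -/

/-- A twice continuously differentiable pair (sound speed, velocity) on a set `S` of space-time,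
solving the radial isentropic Euler equations in these variables up to the boundary of `S`. -/
structure IsEulerFlowOn (γ : ℝ) (m : ℕ) (S : Set (ℝ × ℝ)) (h u : ℝ × ℝ → ℝ) : Prop where
  uniqueDiffOn : UniqueDiffOn ℝ S
  subset_closure_interior : S ⊆ closure (interior S)
  contDiffOn_soundSpeed : ContDiffOn ℝ 2 h S
  contDiffOn_velocity : ContDiffOn ℝ 2 u S
  soundSpeed_pos : ∀ p ∈ S, 0 < h p
  radius_pos : ∀ p ∈ S, 0 < p.1
  mass_eq : ∀ p ∈ S,
    dt S h p + u p * dr S h p + (γ - 1) / 2 * (h p * (dr S u p + m * u p / p.1)) = 0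
  momentum_eq : ∀ p ∈ S, dt S u p + u p * dr S u p + 2 / (γ - 1) * (h p * dr S h p) = 0

/-- The quantity `∂ᵣ(u + 2h/(γ-1)) + m u / r`, proportional to the decay rate of `h` along
1-characteristics. -/
noncomputable def decayRate (γ : ℝ) (m : ℕ) (S : Set (ℝ × ℝ)) (h u : ℝ × ℝ → ℝ) (p : ℝ × ℝ) : ℝ :=
  dr S u p + 2 / (γ - 1) * dr S h p + m * u p / p.1

/-- The unweighted variable `β = h^(-κ) β̃`. -/
noncomputable def betaPlain (γ : ℝ) (m : ℕ) (S : Set (ℝ × ℝ)) (h u : ℝ × ℝ → ℝ) (p : ℝ × ℝ) : ℝ :=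
  dr S u p - 2 / (γ - 1) * dr S h p - m * h p * u p / (p.1 * (u p - h p))

/-- The weighted variable `β̃` as a function on space-time. -/
noncomputable def betaField (γ : ℝ) (m : ℕ) (S : Set (ℝ × ℝ)) (h u : ℝ × ℝ → ℝ) (p : ℝ × ℝ) : ℝ :=
  h p ^ weightExp γ * betaPlain γ m S h u p

namespace IsEulerFlowOn

variable {γ : ℝ} {m : ℕ} {S : Set (ℝ × ℝ)} {h u : ℝ × ℝ → ℝ} {p : ℝ × ℝ}

theorem partials_soundSpeed (H : IsEulerFlowOn γ m S h u) (hp : p ∈ S) :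
    HasPartialsWithinAt h (dr S h p) (dt S h p) S p :=
  hasPartialsWithinAt_of_contDiffOn H.contDiffOn_soundSpeed hp

theorem partials_velocity (H : IsEulerFlowOn γ m S h u) (hp : p ∈ S) :
    HasPartialsWithinAt u (dr S u p) (dt S u p) S p :=
  hasPartialsWithinAt_of_contDiffOn H.contDiffOn_velocity hp

theorem partials_dr_soundSpeed (H : IsEulerFlowOn γ m S h u) (hp : p ∈ S) :
    HasPartialsWithinAt (dr S h) (dr S (dr S h) p) (dt S (dr S h) p) S p :=
  hasPartialsWithinAt_dr H.uniqueDiffOn H.contDiffOn_soundSpeed hp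

theorem partials_dr_velocity (H : IsEulerFlowOn γ m S h u) (hp : p ∈ S) :
    HasPartialsWithinAt (dr S u) (dr S (dr S u) p) (dt S (dr S u) p) S p :=
  hasPartialsWithinAt_dr H.uniqueDiffOn H.contDiffOn_velocity hp

theorem partials_dt_soundSpeed (H : IsEulerFlowOn γ m S h u) (hp : p ∈ S) :
    HasPartialsWithinAt (dt S h) (dt S (dr S h) p) (dt S (dt S h) p) S p :=
  hasPartialsWithinAt_dt H.uniqueDiffOn H.subset_closure_interior H.contDiffOn_soundSpeed hp

theorem partials_dt_velocity (H : IsEulerFlowOn γ m S h u) (hp : p ∈ S) :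
    HasPartialsWithinAt (dt S u) (dt S (dr S u) p) (dt S (dt S u) p) S p :=
  hasPartialsWithinAt_dt H.uniqueDiffOn H.subset_closure_interior H.contDiffOn_velocity hp

theorem dr_mass_eq (H : IsEulerFlowOn γ m S h u) (hp : p ∈ S) :
    dt S (dr S h) p = -(dr S u p * dr S h p + u p * dr S (dr S h) p
      + (γ - 1) / 2 * (dr S h p * (dr S u p + m * u p / p.1)
        + h p * (dr S (dr S u) p + m * (dr S u p / p.1 - u p / p.1 ^ 2)))) := by
  have hr := (H.radius_pos p hp).ne'
  have h1 := ((H.partials_dt_soundSpeed hp).add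
    ((H.partials_velocity hp).mul (H.partials_dr_soundSpeed hp))).add
    (((H.partials_soundSpeed hp).mul ((H.partials_dr_velocity hp).add
      (((H.partials_velocity hp).const_mul m).div .fst hr))).const_mul ((γ - 1) / 2))
  have h2 := (HasPartialsWithinAt.const 0).congr H.mass_eq hp
  have h3 := (h1.unique (H.uniqueDiffOn p hp) h2).1
  field_simp at h3 ⊢
  linear_combination h3

theorem dr_momentum_eq (H : IsEulerFlowOn γ m S h u) (hp : p ∈ S) :
    dt S (dr S u) p = -(dr S u p ^ 2 + u p * dr S (dr S u) p
      + 2 / (γ - 1) * (dr S h p ^ 2 + h p * dr S (dr S h) p)) := by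
  have h1 := ((H.partials_dt_velocity hp).add
    ((H.partials_velocity hp).mul (H.partials_dr_velocity hp))).add
    (((H.partials_soundSpeed hp).mul (H.partials_dr_soundSpeed hp)).const_mul (2 / (γ - 1)))
  have h2 := (HasPartialsWithinAt.const 0).congr H.momentum_eq hp
  have h3 := (h1.unique (H.uniqueDiffOn p hp) h2).1
  linear_combination h3

theorem dt_soundSpeed_eq (H : IsEulerFlowOn γ m S h u) (hp : p ∈ S) :
    dt S h p = -(u p * dr S h p + (γ - 1) / 2 * (h p * (dr S u p + m * u p / p.1))) := by
  linear_combination H.mass_eq p hp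

theorem dt_velocity_eq (H : IsEulerFlowOn γ m S h u) (hp : p ∈ S) :
    dt S u p = -(u p * dr S u p + 2 / (γ - 1) * (h p * dr S h p)) := by
  linear_combination H.momentum_eq p hp

theorem transport_soundSpeed (H : IsEulerFlowOn γ m S h u) (hγ : γ - 1 ≠ 0) (hp : p ∈ S) :
    (u p - h p) * dr S h p + dt S h p = -((γ - 1) / 2 * h p * decayRate γ m S h u p) := by
  rw [H.dt_soundSpeed_eq hp, decayRate]
  have hr := (H.radius_pos p hp).ne'
  field_simp
  ring

theorem transport_velocity (H : IsEulerFlowOn γ m S h u) (hp : p ∈ S) :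
    (u p - h p) * dr S u p + dt S u p = -(h p * (decayRate γ m S h u p - m * u p / p.1)) := by
  rw [H.dt_velocity_eq hp, decayRate]
  ring

theorem transport_riemann (H : IsEulerFlowOn γ m S h u) (hγ : γ - 1 ≠ 0) (hp : p ∈ S) :
    (u p + h p) * (dr S u p + 2 / (γ - 1) * dr S h p) + (dt S u p + 2 / (γ - 1) * dt S h p)
      = -(m * h p * u p / p.1) := by
  rw [H.dt_soundSpeed_eq hp, H.dt_velocity_eq hp]
  have hr := (H.radius_pos p hp).ne'
  field_simp
  ring

/-- The second derivatives cancel because E differentiates u + 2h/(γ-1), the Riemann invariant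
belonging to the speed u + h. -/
theorem partials_decayRate (H : IsEulerFlowOn γ m S h u) (hγ : γ - 1 ≠ 0) (hp : p ∈ S) :
    ∃ a b, HasPartialsWithinAt (decayRate γ m S h u) a b S p ∧
      (u p + h p) * a + b = -((dr S u p + dr S h p) * (dr S u p + 2 / (γ - 1) * dr S h p))
        - m * (dr S h p * u p + 2 / (γ - 1) * (h p * dr S h p)) / p.1 - m * u p ^ 2 / p.1 ^ 2 := by
  have hr := (H.radius_pos p hp).ne'
  refine ⟨_, _, ((H.partials_dr_velocity hp).add ((H.partials_dr_soundSpeed hp).const_mul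
    (2 / (γ - 1)))).add (((H.partials_velocity hp).const_mul m).div .fst hr), ?_⟩
  rw [H.dr_mass_eq hp, H.dr_momentum_eq hp, H.dt_velocity_eq hp]
  field_simp
  ring

/-- Here u - 2h/(γ-1) belongs to the speed u - h, so second derivatives cancel again. The
combination E - m u²/(r(u+h)) is the unweighted form of α̃. -/
theorem partials_betaPlain (H : IsEulerFlowOn γ m S h u) (hγ : γ - 1 ≠ 0) (hp : p ∈ S)
    (hP : u p + h p ≠ 0) (hQ : u p - h p ≠ 0) :
    ∃ a b, HasPartialsWithinAt (betaPlain γ m S h u) a b S p ∧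
      (u p - h p) * a + b = -((γ + 1) / 4 * betaPlain γ m S h u p ^ 2)
        + (γ - 3) / 4 * betaPlain γ m S h u p
          * (decayRate γ m S h u p - m * u p ^ 2 / (p.1 * (u p + h p)))
        - m / p.1 * betaPlain γ m S h u p * h p * u p
          * ((γ + 1) / (4 * (u p - h p)) + (γ - 3) / (4 * (u p + h p)))
        + m / (p.1 * (u p - h p) ^ 2)
          * ((u p + h p) * (decayRate γ m S h u p - m * u p ^ 2 / (p.1 * (u p + h p)))
            * (u p ^ 2 * (γ - 1) / 4 - h p ^ 2 / 2)
          - (u p - h p) * betaPlain γ m S h u p * (u p ^ 2 * (γ - 1) / 4 + h p ^ 2 / 2)) := by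
  have hr := (H.radius_pos p hp).ne'
  refine ⟨_, _, ((H.partials_dr_velocity hp).sub ((H.partials_dr_soundSpeed hp).const_mul
    (2 / (γ - 1)))).sub ((((H.partials_soundSpeed hp).const_mul m).mul
      (H.partials_velocity hp)).div (HasPartialsWithinAt.fst.mul
        ((H.partials_velocity hp).sub (H.partials_soundSpeed hp))) (mul_ne_zero hr hQ)), ?_⟩
  rw [H.dr_mass_eq hp, H.dr_momentum_eq hp, H.dt_velocity_eq hp, H.dt_soundSpeed_eq hp,
    betaPlain, decayRate]
  generalize dr S (dr S h) p = hrr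
  generalize dr S (dr S u) p = urr
  generalize dr S h p = hr' at *
  generalize dr S u p = ur at *
  generalize u p = v at *
  generalize h p = w at *
  generalize p.1 = r at *
  generalize (m : ℝ) = n at *
  field_simp
  ring

/-- Along 1-characteristics the logarithmic derivative of h^κ is -κ(γ-1)/2 · E = -(γ-3)/4 · E, which
cancels the βE term of the unweighted equation. This fixes the exponent κ. -/
theorem partials_betaField (H : IsEulerFlowOn γ m S h u) (hγ : γ - 1 ≠ 0) (hp : p ∈ S)
    (hP : u p + h p ≠ 0) (hQ : u p - h p ≠ 0) :
    ∃ a b, HasPartialsWithinAt (betaField γ m S h u) a b S p ∧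
      (u p - h p) * a + b = h p ^ weightExp γ * (-((γ + 1) / 4 * betaPlain γ m S h u p ^ 2)
        - m / p.1 * betaPlain γ m S h u p * ((u p + h p) ^ 2 + (γ - 3) * u p ^ 2)
          / (2 * (u p - h p))
        + m * (u p + h p) / (p.1 * (u p - h p) ^ 2)
          * (decayRate γ m S h u p - m * u p ^ 2 / (p.1 * (u p + h p)))
          * (u p ^ 2 * (γ - 1) / 4 - h p ^ 2 / 2)) := by
  obtain ⟨a, b, hab, heq⟩ := H.partials_betaPlain hγ hp hP hQ
  have hr := (H.radius_pos p hp).ne'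
  have hh := H.soundSpeed_pos p hp
  refine ⟨_, _, ((H.partials_soundSpeed hp).rpow_const (weightExp γ) hh).mul hab, ?_⟩
  have hT := H.transport_soundSpeed hγ hp
  have hh' := hh.ne'
  -- Regroups the terms so that the derivative of h appears only in the combination given by
  -- `transport_soundSpeed`. D does not occur in the identity, so its value is arbitrary.
  have hsplit : ∀ W B D x y : ℝ, (u p - h p) * (weightExp γ * W / h p * x * B + W * a)
      + (weightExp γ * W / h p * y * B + W * b)
      = W * (weightExp γ / h p * ((u p - h p) * x + y) * B + ((u p - h p) * a + b)) := by
    intros; ring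
  rw [hsplit _ _ 0, hT, heq]
  congr 1
  rw [weightExp]
  generalize betaPlain γ m S h u p = B
  generalize decayRate γ m S h u p = E
  field_simp
  ring

end IsEulerFlowOn

/-! ### From the conservation laws to the equations for h and u. -/

section Conversion

open Filter Topology

variable {f : ℝ × ℝ → ℝ} {S : Set (ℝ × ℝ)} {a b r t : ℝ}

theorem HasPartialsWithinAt.hasDerivAt_fst (hf : HasPartialsWithinAt f a b S (r, t))
    (hS : S ∈ 𝓝 (r, t)) : HasDerivAt (fun x => f (x, t)) a r := by
  have h : HasPartialsWithinAt f a b univ (r, t) := by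
    unfold HasPartialsWithinAt at *
    exact (hf.hasFDerivAt hS).hasFDerivWithinAt
  exact (h.slice (I := univ) fun _ _ => mem_univ _).hasDerivAt univ_mem

theorem HasPartialsWithinAt.hasDerivAt_snd (hf : HasPartialsWithinAt f a b S (r, t))
    (hS : S ∈ 𝓝 (r, t)) : HasDerivAt (fun s => f (r, s)) b t := by
  have h : HasPartialsWithinAt f a b univ (r, t) := by
    unfold HasPartialsWithinAt at *
    exact (hf.hasFDerivAt hS).hasFDerivWithinAt
  have := (h.comp_curve (X := fun _ => r) (hasDerivWithinAt_const t univ r)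
    fun _ _ => mem_univ _).hasDerivAt univ_mem
  simpa using this

theorem soundSpeed_pos {K γ x : ℝ} (hK : 0 < K) (hγ : 0 < γ) (hx : 0 < x) :
    0 < soundSpeed K γ x :=
  mul_pos (Real.sqrt_pos.2 (mul_pos hK hγ)) (Real.rpow_pos_of_pos hx _)

theorem soundSpeed_sq {K γ x : ℝ} (hK : 0 < K) (hγ : 0 < γ) (hx : 0 < x) :
    soundSpeed K γ x ^ 2 = K * γ * x ^ (γ - 1) := by
  rw [soundSpeed, mul_pow, Real.sq_sqrt (mul_pos hK hγ).le, ← Real.rpow_natCast (x ^ _),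
    ← Real.rpow_mul hx.le]
  congr 2
  push_cast
  ring

/-- In the interior, subtract u times mass from momentum, divide out r^m, and use h² = Kγρ^(γ-1)
with h_r = (γ-1)/2 · (h/ρ) ρ_r, and likewise in t. Continuity of the first derivatives carries the
equations to the boundary. -/
theorem IsSmoothSolution.isEulerFlowOn {K γ : ℝ} (hK : 0 < K) (hγ : 1 < γ) {m : ℕ}
    {r₁ r₂ : ℝ} {h₀ u₀ : ℝ → ℝ} {τ σ : ℝ} {ρ u : ℝ → ℝ → ℝ} {b₁ b₂ : ℝ → ℝ}
    (H : IsSmoothSolution K γ m r₁ r₂ h₀ u₀ τ ρ u b₁ b₂) (hσ : σ ≤ τ)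
    (hlt : ∀ t ∈ Ico 0 σ, b₁ t < b₂ t) (hpos : ∀ t ∈ Ico 0 σ, 0 < b₁ t) :
    IsEulerFlowOn γ m (region b₁ b₂ σ) (fun p => soundSpeed K γ (ρ p.1 p.2))
      (fun p => u p.1 p.2) := by
  have hsub : region b₁ b₂ σ ⊆ region b₁ b₂ τ := fun p hp => ⟨⟨hp.1.1, hp.1.2.trans_le hσ⟩, hp.2⟩
  have hI : Ico 0 σ ⊆ Ico 0 τ := Ico_subset_Ico_right hσ
  have hd₁ : DifferentiableOn ℝ b₁ (Ico 0 σ) := fun t ht =>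
    ((H.left_char t (hI ht)).mono hI).differentiableWithinAt
  have hd₂ : DifferentiableOn ℝ b₂ (Ico 0 σ) := fun t ht =>
    ((H.right_char t (hI ht)).mono hI).differentiableWithinAt
  have hU := uniqueDiffOn_region hlt hd₁ hd₂
  have hρ : ContDiffOn ℝ 2 (fun p : ℝ × ℝ => ρ p.1 p.2) (region b₁ b₂ σ) :=
    H.smooth_density.mono hsub
  have hu : ContDiffOn ℝ 2 (fun p : ℝ × ℝ => u p.1 p.2) (region b₁ b₂ σ) :=
    H.smooth_velocity.mono hsub
  have hρpos : ∀ p ∈ region b₁ b₂ σ, 0 < ρ p.1 p.2 := fun p hp => H.density_pos p (hsub hp)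
  have hr : ∀ p ∈ region b₁ b₂ σ, 0 < p.1 := fun p hp => (hpos p.2 hp.1).trans_le hp.2.1
  have hh : ContDiffOn ℝ 2 (fun p : ℝ × ℝ => soundSpeed K γ (ρ p.1 p.2)) (region b₁ b₂ σ) :=
    contDiffOn_const.mul (hρ.rpow_const_of_ne fun p hp => (hρpos p hp).ne')
  have hγ1 : γ - 1 ≠ 0 := by linarith
  set S := region b₁ b₂ σ with hS
  set D : Set (ℝ × ℝ) := {p : ℝ × ℝ | p.2 ∈ Ioo 0 σ ∧ p.1 ∈ Ioo (b₁ p.2) (b₂ p.2)} with hD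
  have hDS : D ⊆ S := interior_subset_region
  have hDcl : S ⊆ closure D := region_subset_closure hlt hd₁.continuousOn hd₂.continuousOn
  have hDo : IsOpen D := isOpen_interior_region hd₁.continuousOn hd₂.continuousOn
  have hcr : ContinuousOn (fun p : ℝ × ℝ => p.1) S := continuous_fst.continuousOn
  have key : ∀ p ∈ D,
      dt S (fun p => soundSpeed K γ (ρ p.1 p.2)) p
        + u p.1 p.2 * dr S (fun p => soundSpeed K γ (ρ p.1 p.2)) p
        + (γ - 1) / 2 * (soundSpeed K γ (ρ p.1 p.2)
          * (dr S (fun p => u p.1 p.2) p + m * u p.1 p.2 / p.1)) = 0 ∧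
      dt S (fun p => u p.1 p.2) p + u p.1 p.2 * dr S (fun p => u p.1 p.2) p
        + 2 / (γ - 1) * (soundSpeed K γ (ρ p.1 p.2)
          * dr S (fun p => soundSpeed K γ (ρ p.1 p.2)) p) = 0 := by
    rintro ⟨r, t⟩ hp
    have hpS := hDS hp
    have hnhds : S ∈ 𝓝 (r, t) := Filter.mem_of_superset (hDo.mem_nhds hp) hDS
    have hR := hasPartialsWithinAt_of_contDiffOn hρ hpS
    have hV := hasPartialsWithinAt_of_contDiffOn hu hpS
    have hW := hasPartialsWithinAt_of_contDiffOn hh hpS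
    have hx : 0 < ρ r t := hρpos _ hpS
    have hrpos : 0 < r := hr _ hpS
    have hsp := soundSpeed_pos hK (by linarith : 0 < γ) hx
    have hsq := soundSpeed_sq hK (by linarith : 0 < γ) hx
    have hW' := (hR.rpow_const ((γ - 1) / 2) hx).const_mul (Real.sqrt (K * γ))
    obtain ⟨e1, e2⟩ := hW.unique (hU _ hpS) hW'
    have hRr := hR.hasDerivAt_fst hnhds
    have hRt := hR.hasDerivAt_snd hnhds
    have hVr := hV.hasDerivAt_fst hnhds
    have hVt := hV.hasDerivAt_snd hnhds
    have hτ : t ∈ Ioo 0 τ := ⟨hp.1.1, hp.1.2.trans_le hσ⟩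
    have M := H.mass t hτ r hp.2
    have N := H.momentum t hτ r hp.2
    have d1 : HasDerivAt (fun s => r ^ m * ρ r s) _ t := hRt.const_mul (r ^ m)
    have d2 : HasDerivAt (fun x => x ^ m * ρ x t * u x t) _ r :=
      ((hasDerivAt_pow m r).fun_mul hRr).fun_mul hVr
    have d3 : HasDerivAt (fun s => r ^ m * ρ r s * u r s) _ t := d1.fun_mul hVt
    have d4 : HasDerivAt (fun x => x ^ m * ρ x t * u x t ^ 2) _ r :=
      ((hasDerivAt_pow m r).fun_mul hRr).fun_mul (hVr.fun_pow 2)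
    have d5 : HasDerivAt (fun x => K * ρ x t ^ γ) _ r :=
      (hRr.rpow_const (p := γ) (Or.inl hx.ne')).const_mul K
    rw [d1.deriv, d2.deriv] at M
    rw [d3.deriv, d4.deriv, d5.deriv] at N
    simp only at M N e1 e2 ⊢
    -- Removes the truncated subtraction m - 1; for m = 0 both sides vanish.
    have hpow : (m : ℝ) * r ^ (m - 1) = r ^ m * (m / r) := by
      rcases Nat.eq_zero_or_pos m with h0 | h0
      · simp [h0]
      · obtain ⟨k, rfl⟩ := Nat.exists_eq_add_of_le' h0
        rw [Nat.add_sub_cancel, pow_succ]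
        field_simp
    rw [hpow] at M N
    have hrm : r ^ m ≠ 0 := (pow_pos hrpos m).ne'
    generalize dr S (fun p => ρ p.1 p.2) (r, t) = Rr at *
    generalize dt S (fun p => ρ p.1 p.2) (r, t) = Rt at *
    generalize dr S (fun p => u p.1 p.2) (r, t) = Vr at *
    generalize dt S (fun p => u p.1 p.2) (r, t) = Vt at *
    have M' : Rt + m / r * ρ r t * u r t + Rr * u r t + ρ r t * Vr = 0 := by
      refine (mul_eq_zero.1 (?_ : r ^ m * _ = 0)).resolve_left hrm
      linear_combination M
    have N' : ρ r t * (Vt + u r t * Vr) + K * γ * ρ r t ^ (γ - 1) * Rr = 0 := by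
      refine (mul_eq_zero.1 (?_ : r ^ m * _ = 0)).resolve_left hrm
      push_cast at N
      simp only [pow_one] at N
      linear_combination N - u r t * M
    have e1' : dr S (fun p => soundSpeed K γ (ρ p.1 p.2)) (r, t)
        = (γ - 1) / 2 * soundSpeed K γ (ρ r t) / ρ r t * Rr := by
      rw [e1, soundSpeed]; ring
    have e2' : dt S (fun p => soundSpeed K γ (ρ p.1 p.2)) (r, t)
        = (γ - 1) / 2 * soundSpeed K γ (ρ r t) / ρ r t * Rt := by
      rw [e2, soundSpeed]; ring
    rw [e1', e2']
    rw [← hsq] at N'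
    generalize soundSpeed K γ (ρ r t) = w at *
    constructor
    · field_simp at M' ⊢
      linear_combination (γ - 1) * w * M'
    · field_simp at N' ⊢
      linear_combination N'
  have hch := hh.continuousOn
  have hcu := hu.continuousOn
  have hchr := (contDiffOn_dr hU hh).continuousOn
  have hcht := (contDiffOn_dt hU hh).continuousOn
  have hcur := (contDiffOn_dr hU hu).continuousOn
  have hcut := (contDiffOn_dt hU hu).continuousOn
  refine ⟨hU, region_subset_closure_interior hlt hd₁.continuousOn hd₂.continuousOn, hh, hu,
    fun p hp => soundSpeed_pos hK (by linarith) (hρpos p hp), hr, ?_, ?_⟩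
  · refine EqOn.of_subset_closure (fun p hp => (key p hp).1) ?_ continuousOn_const hDS hDcl
    exact (hcht.add (hcu.mul hchr)).add (continuousOn_const.mul (hch.mul
      (hcur.add ((continuousOn_const.mul hcu).div hcr fun p hp => (hr p hp).ne'))))
  · refine EqOn.of_subset_closure (fun p hp => (key p hp).2) ?_ continuousOn_const hDS hDcl
    exact (hcut.add (hcu.mul hcur)).add (continuousOn_const.mul (hch.mul hchr))

end Conversion

/-! ### Propagation of the a priori bounds. -/

section Bootstrap

open Filter Topology

/-- On E = 0 the two gradients are determined by z = ∂ᵣ(u - 2h/(γ-1)) alone. The source of E becomes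
affine in z with the negative factor v + w, so strong compression makes it positive. -/
theorem decay_source_pos {γ m r v w x y B : ℝ} (hγ : 3 ≤ γ) (hm : 1 ≤ m) (hr : 0 < r) (hw : 0 < w)
    (hvw : v < -2 * w) (hE : x + 2 / (γ - 1) * y + m * v / r = 0)
    (hB : B = x - 2 / (γ - 1) * y - m * w * v / (r * (v - w))) (hBr : B * r ≤ 8 * m * v) :
    0 < -((x + y) * (x + 2 / (γ - 1) * y))
        - m * (y * v + 2 / (γ - 1) * (w * y)) / r - m * v ^ 2 / r ^ 2 := by
  have hγ1 : γ - 1 ≠ 0 := by linarith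
  obtain ⟨z, hz⟩ : ∃ z, z = x - 2 / (γ - 1) * y := ⟨_, rfl⟩
  have hx : x = (z - m * v / r) / 2 := by linear_combination (1 / 2) * hE + (-1 / 2) * hz
  have hy : y = (γ - 1) / 4 * (-(m * v / r) - z) := by
    have : 2 / (γ - 1) * y = (-(m * v / r) - z) / 2 := by
      linear_combination (1 / 2) * hE + (1 / 2) * hz
    field_simp at this ⊢
    linarith
  have hid : -((x + y) * (x + 2 / (γ - 1) * y))
        - m * (y * v + 2 / (γ - 1) * (w * y)) / r - m * v ^ 2 / r ^ 2
      = m / (2 * r ^ 2) * ((v + w) * (z * r) - m * v ^ 2 + m * (v * w) - 2 * v ^ 2) := by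
    rw [hx, hy]
    field_simp
    ring
  rw [hid]
  refine mul_pos (by positivity) ?_
  have hvneg : v < 0 := by linarith
  have hQ : v - w < 0 := by linarith
  -- Passing from B to z costs at most m w < -m v/2, so 8 may be lowered to 7. The final bracket
  -- then exceeds (2m - 2)v² ≥ 0, strictly because v < -2w.
  have hzr : z * r ≤ 7 * m * v := by
    have h1 : z * r = B * r + m * (w * v / (v - w)) := by
      rw [hB, hz]
      field_simp
      ring
    have h2 : w * v / (v - w) ≤ w := by
      rw [div_le_iff_of_neg hQ]
      nlinarith
    have h3 := mul_le_mul_of_nonneg_left h2 (by linarith : 0 ≤ m)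
    nlinarith
  have h1 : v / 2 * (7 * m * v) ≤ (v + w) * (z * r) := by
    have h2 : 7 * m * v ≤ 0 := by nlinarith
    nlinarith
  have h4 : -(v ^ 2 / 2) ≤ v * w := by nlinarith
  have h5 := mul_le_mul_of_nonneg_left h4 (by linarith : 0 ≤ m)
  have h6 : 0 < v ^ 2 := sq_pos_of_neg hvneg
  nlinarith

/-- For γ ≥ 3 the square term alone is at most -B². The linear term is strictly negative, and the
last one is nonpositive: v + w < 0 multiplies two nonnegative factors. -/
theorem beta_source_lt {γ m r v w E B : ℝ} (hγ : 3 ≤ γ) (hm : 1 ≤ m) (hr : 0 < r) (hw : 0 < w)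
    (hvw : v < -2 * w) (hE : 0 ≤ E) (hB : B < 0) :
    -((γ + 1) / 4 * B ^ 2) - m / r * B * ((v + w) ^ 2 + (γ - 3) * v ^ 2) / (2 * (v - w))
        + m * (v + w) / (r * (v - w) ^ 2) * (E - m * v ^ 2 / (r * (v + w)))
          * (v ^ 2 * (γ - 1) / 4 - w ^ 2 / 2) < -B ^ 2 := by
  have hP : v + w < 0 := by linarith
  have hQ : v - w < 0 := by linarith
  have h1 : 0 < (v + w) ^ 2 + (γ - 3) * v ^ 2 := by
    have : 0 < (v + w) ^ 2 := sq_pos_of_neg hP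
    nlinarith [sq_nonneg v]
  have h2 : m / r * B * ((v + w) ^ 2 + (γ - 3) * v ^ 2) / (2 * (v - w)) > 0 := by
    refine div_pos_of_neg_of_neg (mul_neg_of_neg_of_pos (mul_neg_of_pos_of_neg (by positivity) hB)
      h1) (by linarith)
  have h3 : 0 ≤ v ^ 2 * (γ - 1) / 4 - w ^ 2 / 2 := by nlinarith [sq_nonneg v]
  have h4 : 0 ≤ E - m * v ^ 2 / (r * (v + w)) := by
    have : m * v ^ 2 / (r * (v + w)) ≤ 0 :=
      div_nonpos_of_nonneg_of_nonpos (by positivity) (mul_nonpos_of_nonneg_of_nonpos hr.le hP.le)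
    linarith
  have h5 : m * (v + w) / (r * (v - w) ^ 2) ≤ 0 :=
    div_nonpos_of_nonpos_of_nonneg (by nlinarith) (by positivity)
  have h6 := mul_nonpos_of_nonpos_of_nonneg (mul_nonpos_of_nonpos_of_nonneg h5 h4) h3
  nlinarith [sq_nonneg B]

/-- The a priori bounds propagated by the flow. -/
def IsCompressed (γ : ℝ) (m : ℕ) (hHi uLo uHi βLo : ℝ) (S : Set (ℝ × ℝ)) (h u : ℝ × ℝ → ℝ)
    (p : ℝ × ℝ) : Prop :=
  h p < hHi ∧ u p < -uHi ∧ -uLo < u p + 2 / (γ - 1) * h p ∧ 0 < decayRate γ m S h u p ∧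
    betaField γ m S h u p < -βLo

theorem weightExp_nonneg {γ : ℝ} (hγ : 3 ≤ γ) : 0 ≤ weightExp γ :=
  div_nonneg (by linarith) (by linarith)

variable {γ : ℝ} {m : ℕ} {b₁ b₂ : ℝ → ℝ} {σ r₀ hHi uLo uHi βLo : ℝ} {h u : ℝ × ℝ → ℝ}

theorem neg_velocity_le {v w : ℝ} (hγ : 3 ≤ γ) (hw : 0 < w) (hwh : w ≤ hHi)
    (hvw : -uLo ≤ v + 2 / (γ - 1) * w) : -(uLo + hHi) ≤ v := by
  have : 2 / (γ - 1) ≤ 1 := (div_le_one (by linarith)).2 (by linarith)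
  nlinarith

theorem betaPlain_le {S : Set (ℝ × ℝ)} {p : ℝ × ℝ} {M : ℝ} (hγ : 3 ≤ γ) (hp : 0 < h p)
    (hph : h p ≤ hHi) (hβ : betaField γ m S h u p ≤ -βLo) (hM : 0 ≤ M)
    (hβM : hHi ^ weightExp γ * M ≤ βLo) : betaPlain γ m S h u p ≤ -M := by
  have hκ := Real.rpow_le_rpow hp.le hph (weightExp_nonneg hγ)
  have h1 := Real.rpow_pos_of_pos hp (weightExp γ)
  have h2 := Real.rpow_pos_of_pos (hp.trans_le hph) (weightExp γ)
  rw [betaField] at hβ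
  by_contra! hcon
  nlinarith

theorem betaPlain_mul_le {S : Set (ℝ × ℝ)} {p : ℝ × ℝ} (hγ : 3 ≤ γ) (hr₀ : 0 < r₀)
    (huLo : 0 < uLo) (hp : 0 < h p) (hpr : r₀ ≤ p.1) (hph : h p ≤ hHi)
    (hw : -uLo ≤ u p + 2 / (γ - 1) * h p) (hβ : betaField γ m S h u p ≤ -βLo)
    (hβM : hHi ^ weightExp γ * (8 * m * (uLo + hHi) / r₀) ≤ βLo) :
    betaPlain γ m S h u p * p.1 ≤ 8 * m * u p := by
  have hL : 0 < uLo + hHi := by linarith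
  have h1 := betaPlain_le hγ hp hph hβ (by positivity) hβM
  have h2 := neg_velocity_le hγ hp hph hw
  have h3 := mul_le_mul_of_nonneg_right h1 (hr₀.le.trans hpr)
  have h4 : 8 * m * (uLo + hHi) ≤ 8 * m * (uLo + hHi) / r₀ * p.1 := by
    rw [div_mul_eq_mul_div, le_div_iff₀ hr₀]
    exact mul_le_mul_of_nonneg_left hpr (by positivity)
  have h5 : (8 * m : ℝ) * -(uLo + hHi) ≤ 8 * m * u p :=
    mul_le_mul_of_nonneg_left h2 (by positivity)
  linarith

/-- At an earliest failing point all five inequalities still hold weakly, which is enough for the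
sources of E and β̃ to have strict signs. Strict positivity of E then settles h and u, and u < 0
settles u + 2h/(γ-1). -/
theorem IsEulerFlowOn.isCompressed_of_initially (H : IsEulerFlowOn γ m (region b₁ b₂ σ) h u)
    (hγ : 3 ≤ γ) (hm : 1 ≤ m) (hr₀ : 0 < r₀) (huLo : 0 < uLo)
    (hHi_lt : hHi < uHi / 2)
    (hb₁ : ∀ t ∈ Ico 0 σ, HasDerivWithinAt b₁ (u (b₁ t, t) + h (b₁ t, t)) (Ico 0 σ) t)
    (hb₂ : ∀ t ∈ Ico 0 σ, HasDerivWithinAt b₂ (u (b₂ t, t) - h (b₂ t, t)) (Ico 0 σ) t)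
    (hlt : ∀ t ∈ Ico 0 σ, b₁ t < b₂ t) (hb₁r : ∀ t ∈ Ico 0 σ, r₀ ≤ b₁ t)
    (hβM : hHi ^ weightExp γ * (8 * m * (uLo + hHi) / r₀) ≤ βLo)
    (hinit : ∀ p ∈ region b₁ b₂ σ, p.2 = 0 →
      IsCompressed γ m hHi uLo uHi βLo (region b₁ b₂ σ) h u p) :
    ∀ p ∈ region b₁ b₂ σ, IsCompressed γ m hHi uLo uHi βLo (region b₁ b₂ σ) h u p := by
  set S := region b₁ b₂ σ with hS
  have hγ1 : γ - 1 ≠ 0 := by linarith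
  have hc₁ : ContinuousOn b₁ (Ico 0 σ) := fun t ht => (hb₁ t ht).continuousWithinAt
  have hc₂ : ContinuousOn b₂ (Ico 0 σ) := fun t ht => (hb₂ t ht).continuousWithinAt
  have hcE : ∀ p ∈ S, ContinuousWithinAt (decayRate γ m S h u) S p := fun p hp => by
    obtain ⟨a, b, hab, -⟩ := H.partials_decayRate hγ1 hp
    exact hab.continuousWithinAt
  have hch : ∀ p ∈ S, ContinuousWithinAt h S p := H.contDiffOn_soundSpeed.continuousOn
  have hcu : ∀ p ∈ S, ContinuousWithinAt u S p := H.contDiffOn_velocity.continuousOn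
  have hcw : ∀ p ∈ S, ContinuousWithinAt (fun q => u q + 2 / (γ - 1) * h q) S p := fun p hp =>
    (hcu p hp).add (continuousWithinAt_const.mul (hch p hp))
  refine forall_mem_region_of_forall_earlier hlt hc₁ hc₂ ?_ hinit ?_
  · rintro p hp ⟨h1, h2, h3, h4, h5⟩
    have hh := H.soundSpeed_pos p hp
    obtain ⟨a, b, hab, -⟩ := H.partials_betaField hγ1 hp (by linarith) (by linarith)
    filter_upwards [(hch p hp).eventually_lt continuousWithinAt_const h1,
      (hcu p hp).eventually_lt continuousWithinAt_const h2,
      continuousWithinAt_const.eventually_lt (hcw p hp) h3,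
      continuousWithinAt_const.eventually_lt (hcE p hp) h4,
      hab.continuousWithinAt.eventually_lt continuousWithinAt_const h5] with q q1 q2 q3 q4 q5
    exact ⟨q1, q2, q3, q4, q5⟩
  · intro p hp h0 hearlier
    -- Points at the same time as p are included, as limits of earlier ones, since the maximum
    -- principle also compares values in space.
    have weak : ∀ q ∈ S, q.2 ≤ p.2 → 0 ≤ hHi - h q ∧ 0 ≤ -uHi - u q ∧
        0 ≤ u q + 2 / (γ - 1) * h q + uLo ∧ 0 ≤ decayRate γ m S h u q ∧
        0 ≤ -βLo - betaField γ m S h u q := by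
      intro q hq hqt
      rcases hqt.lt_or_eq with hqt | hqt
      · obtain ⟨h1, h2, h3, h4, h5⟩ := hearlier q hq hqt
        exact ⟨by linarith, by linarith, by linarith, h4.le, by linarith⟩
      · rw [← hqt] at hearlier h0
        have lim := fun {G : ℝ × ℝ → ℝ} => nonneg_of_forall_earlier_pos (G := G) hlt hc₁ hc₂ hq h0
        have h1 : 0 ≤ hHi - h q := lim (continuousWithinAt_const.sub (hch q hq))
          fun q' hq' ht => sub_pos.2 (hearlier q' hq' ht).1
        have h2 : 0 ≤ -uHi - u q := lim (continuousWithinAt_const.sub (hcu q hq))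
          fun q' hq' ht => sub_pos.2 (hearlier q' hq' ht).2.1
        have hh := H.soundSpeed_pos q hq
        obtain ⟨a, b, hab, -⟩ := H.partials_betaField hγ1 hq (by linarith) (by linarith)
        refine ⟨h1, h2, ?_, lim (hcE q hq) fun q' hq' ht => (hearlier q' hq' ht).2.2.2.1,
          lim (continuousWithinAt_const.sub hab.continuousWithinAt)
            fun q' hq' ht => sub_pos.2 (hearlier q' hq' ht).2.2.2.2⟩
        refine lim ((hcw q hq).add continuousWithinAt_const) fun q' hq' ht => ?_
        have := (hearlier q' hq' ht).2.2.1
        change 0 < u q' + 2 / (γ - 1) * h q' + uLo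
        linarith
    obtain ⟨w1, w2, w3, w4, w5⟩ := weak p hp le_rfl
    have hh := H.soundSpeed_pos p hp
    have hr := H.radius_pos p hp
    have hm' : (1 : ℝ) ≤ m := by exact_mod_cast hm
    have hpr : r₀ ≤ p.1 := (hb₁r p.2 hp.1).trans hp.2.1
    have hvw : u p < -2 * h p := by linarith
    have hP : u p + h p < 0 := by linarith
    have hQ : u p - h p < 0 := by linarith
    have hBr := betaPlain_mul_le hγ hr₀ huLo hh hpr (by linarith) (by linarith)
      (by linarith : betaField γ m S h u p ≤ -βLo) hβM
    have hB : betaPlain γ m S h u p < 0 := by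
      by_contra! hcon
      have h1 := mul_nonneg hcon hr.le
      nlinarith
    -- Both characteristic speeds are admissible on both edges: the left edge moves with u + h, the
    -- right one with u - h.
    have plus : ∀ {G : ℝ × ℝ → ℝ} {a b : ℝ}, HasPartialsWithinAt G a b S p →
        (∀ q ∈ S, q.2 ≤ p.2 → 0 ≤ G q) → G p ≤ 0 → (u p + h p) * a + b ≤ 0 := by
      intro G a b hG hnn hz
      refine HasPartialsWithinAt.directional_nonpos hlt hp h0 (hb₁ p.2 hp.1) (hb₂ p.2 hp.1) hG hnn
        hz (fun hb => ?_) fun hb => ?_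
      · rw [← hb]
      · rw [← hb]
        change u p - h p ≤ u p + h p
        linarith
    have minus : ∀ {G : ℝ × ℝ → ℝ} {a b : ℝ}, HasPartialsWithinAt G a b S p →
        (∀ q ∈ S, q.2 ≤ p.2 → 0 ≤ G q) → G p ≤ 0 → (u p - h p) * a + b ≤ 0 := by
      intro G a b hG hnn hz
      refine HasPartialsWithinAt.directional_nonpos hlt hp h0 (hb₁ p.2 hp.1) (hb₂ p.2 hp.1) hG hnn
        hz (fun hb => ?_) fun hb => ?_
      · rw [← hb]
        change u p - h p ≤ u p + h p
        linarith
      · rw [← hb]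
    have hE : 0 < decayRate γ m S h u p := by
      by_contra! hcon
      obtain ⟨a, b, hab, heq⟩ := H.partials_decayRate hγ1 hp
      have h1 := plus hab (fun q hq ht => (weak q hq ht).2.2.2.1) hcon
      have h2 := decay_source_pos hγ hm' hr hh hvw (le_antisymm hcon w4) rfl hBr
      linarith
    have hβ : betaField γ m S h u p < -βLo := by
      by_contra! hcon
      obtain ⟨a, b, hab, heq⟩ := H.partials_betaField hγ1 hp hP.ne hQ.ne
      have h1 := minus ((HasPartialsWithinAt.const (-βLo)).sub hab)
        (fun q hq ht => (weak q hq ht).2.2.2.2) (by linarith)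
      have h2 := beta_source_lt hγ hm' hr hh hvw w4 hB
      have h3 := mul_neg_of_pos_of_neg (Real.rpow_pos_of_pos hh (weightExp γ))
        (h2.trans_le (neg_nonpos.2 (sq_nonneg (betaPlain γ m S h u p))))
      linarith
    have hvr : m * u p / p.1 < 0 := div_neg_of_neg_of_pos (by nlinarith) hr
    refine ⟨?_, ?_, ?_, hE, hβ⟩
    · by_contra! hcon
      have h1 := minus ((HasPartialsWithinAt.const hHi).sub (H.partials_soundSpeed hp))
        (fun q hq ht => (weak q hq ht).1) (by linarith)
      have h2 := H.transport_soundSpeed hγ1 hp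
      have h3 : 0 < (γ - 1) / 2 * h p * decayRate γ m S h u p :=
        mul_pos (mul_pos (by linarith) hh) hE
      linarith
    · by_contra! hcon
      have h1 := minus ((HasPartialsWithinAt.const (-uHi)).sub (H.partials_velocity hp))
        (fun q hq ht => (weak q hq ht).2.1) (by linarith)
      have h2 := H.transport_velocity hp
      have h3 : 0 < h p * (decayRate γ m S h u p - m * u p / p.1) := mul_pos hh (by linarith)
      linarith
    · by_contra! hcon
      have h1 := plus (((H.partials_velocity hp).add ((H.partials_soundSpeed hp).const_mul
        (2 / (γ - 1)))).add (.const uLo)) (fun q hq ht => (weak q hq ht).2.2.1) (by linarith)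
      have h2 := H.transport_riemann hγ1 hp
      have h3 : m * h p * u p / p.1 < 0 := div_neg_of_neg_of_pos
        (mul_neg_of_pos_of_neg (by positivity) (by linarith)) hr
      linarith

end Bootstrap

/-! ### Initial bounds and persistence of the region. -/

section Noncollapse

open Filter Topology

/-- Initial data of a supersonic inward wave with compression in `β̃` and decay of the sound speed
along 1-characteristics. -/
structure IsInwardCompressive (γ : ℝ) (m : ℕ) (r₀ r₁ r₂ hHi uLo uHi βLo : ℝ) (h₀ u₀ : ℝ → ℝ) :
    Prop where
  three_le : 3 ≤ γ
  one_le : 1 ≤ m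
  radius_pos : 0 < r₀
  radius_lt : r₀ < r₁
  radii_lt : r₁ < r₂
  hHi_pos : 0 < hHi
  uLo_pos : 0 < uLo
  hHi_lt : hHi < uHi / 2
  compression_le : hHi ^ weightExp γ * (8 * m * (uLo + hHi) / r₀) ≤ βLo
  soundSpeed_bounds : ∀ r ∈ Icc r₁ r₂, 0 < h₀ r ∧ h₀ r < hHi
  velocity_bounds : ∀ r ∈ Icc r₁ r₂, -uLo < u₀ r ∧ u₀ r < -uHi
  decayRate_pos : ∀ r ∈ Icc r₁ r₂, 0 < derivWithin u₀ (Icc r₁ r₂) r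
    + 2 / (γ - 1) * derivWithin h₀ (Icc r₁ r₂) r + m * u₀ r / r
  betaTilde_lt : ∀ r ∈ Icc r₁ r₂, betaTilde γ m (Icc r₁ r₂) h₀ u₀ r < -βLo

variable {γ : ℝ} {m : ℕ} {r₀ r₁ r₂ hHi uLo uHi βLo : ℝ} {h₀ u₀ : ℝ → ℝ}

/-- Substitute the lower bound for αLo into that for βLo and weaken γ + 1 to 4, r₂ to r₀, uLo to uLo
+ hHi and hLo to hHi: what remains is exactly the left side. -/
theorem le_betaLo {hLo αLo : ℝ} (hγ : 3 ≤ γ) (hm : 1 ≤ m) (hr₀ : 0 < r₀) (hr₂ : r₀ ≤ r₂)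
    (hLo_pos : 0 < hLo) (hle : hLo ≤ hHi) (uLo_pos : 0 < uLo)
    (αLo_ge : 2 * m * (uLo + hHi) / r₀ * hHi ^ weightExp γ ≤ αLo)
    (βLo_gt : (γ + 1) * r₂ * αLo ^ 2 / (2 * m * uLo) * hLo ^ (-weightExp γ) < βLo) :
    hHi ^ weightExp γ * (8 * m * (uLo + hHi) / r₀) ≤ βLo := by
  refine le_trans ?_ βLo_gt.le
  have hHi_pos := hLo_pos.trans_le hle
  have hm' : (1 : ℝ) ≤ m := by exact_mod_cast hm
  have hκ := Real.rpow_le_rpow hLo_pos.le hle (weightExp_nonneg hγ)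
  have h1 := Real.rpow_pos_of_pos hLo_pos (weightExp γ)
  rw [Real.rpow_neg hLo_pos.le]
  generalize hLo ^ weightExp γ = x at *
  generalize hHi ^ weightExp γ = y at *
  have hy : 0 < y := h1.trans_le hκ
  have e1 : y * (8 * m * (uLo + hHi) / r₀)
      = 4 * r₀ * (2 * m * (uLo + hHi) / r₀ * y) ^ 2 / (2 * m * (uLo + hHi)) * y⁻¹ := by
    have : uLo + hHi ≠ 0 := by positivity
    field_simp
    ring
  rw [e1]
  have h3 : 0 < 2 * m * (uLo + hHi) / r₀ * y := by positivity
  have h4 : 0 < r₂ := hr₀.trans_le hr₂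
  gcongr <;> linarith

theorem IsInwardCompressive.of_bounds {hLo αLo αHi : ℝ} (hγ : 3 ≤ γ) (hm : 1 ≤ m) (hr₀ : 0 < r₀)
    (hr₁ : r₀ < r₁) (hr₂ : r₁ < r₂) (hLo_pos : 0 < hLo) (uLo_pos : 0 < uLo)
    (hHi_lt : hHi < uHi / 2)
    (h₀_bounds : ∀ r ∈ Icc r₁ r₂, hLo < h₀ r ∧ h₀ r < hHi)
    (u₀_bounds : ∀ r ∈ Icc r₁ r₂, -uLo < u₀ r ∧ u₀ r < -uHi)
    (α₀_bounds : ∀ r ∈ Icc r₁ r₂, αLo < alphaTilde γ m (Icc r₁ r₂) h₀ u₀ r ∧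
      alphaTilde γ m (Icc r₁ r₂) h₀ u₀ r < αHi)
    (β₀_bound : ∀ r ∈ Icc r₁ r₂, betaTilde γ m (Icc r₁ r₂) h₀ u₀ r < -βLo)
    (αLo_ge : 2 * m * (uLo + hHi) / r₀ * hHi ^ weightExp γ ≤ αLo)
    (βLo_gt : (γ + 1) * r₂ * αLo ^ 2 / (2 * m * uLo) * hLo ^ (-weightExp γ) < βLo) :
    IsInwardCompressive γ m r₀ r₁ r₂ hHi uLo uHi βLo h₀ u₀ := by
  have hle : hLo < hHi := (h₀_bounds r₁ ⟨le_rfl, hr₂.le⟩).1.trans (h₀_bounds r₁ ⟨le_rfl, hr₂.le⟩).2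
  have hHi_pos := hLo_pos.trans hle
  refine ⟨hγ, hm, hr₀, hr₁, hr₂, hHi_pos, uLo_pos, hHi_lt,
    le_betaLo hγ hm hr₀ (hr₁.trans hr₂).le hLo_pos hle.le uLo_pos αLo_ge βLo_gt,
    fun r hr => ⟨hLo_pos.trans (h₀_bounds r hr).1, (h₀_bounds r hr).2⟩, u₀_bounds, ?_, β₀_bound⟩
  intro r hr
  have hα := αLo_ge.trans_lt (α₀_bounds r hr).1
  obtain ⟨hw1, hw2⟩ := h₀_bounds r hr
  obtain ⟨hv1, hv2⟩ := u₀_bounds r hr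
  have hw : 0 < h₀ r := hLo_pos.trans hw1
  have hrr : r₀ ≤ r := hr₁.le.trans hr.1
  have hrpos : 0 < r := hr₀.trans_le hrr
  have hκ := Real.rpow_le_rpow hw.le hw2.le (weightExp_nonneg hγ)
  have hκpos := Real.rpow_pos_of_pos hw (weightExp γ)
  rw [alphaTilde] at hα
  generalize derivWithin u₀ (Icc r₁ r₂) r + 2 / (γ - 1) * derivWithin h₀ (Icc r₁ r₂) r = w at *
  generalize u₀ r = v at *
  generalize h₀ r = c at *
  have hP : v + c < 0 := by linarith
  have hM : 0 ≤ 2 * m * (uLo + hHi) / r₀ := by positivity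
  have hA : 2 * m * (uLo + hHi) / r₀ < w + m * c * v / (r * (v + c)) := by
    by_contra! hcon
    have h1 := mul_le_mul_of_nonneg_left hcon hκpos.le
    have h2 := mul_le_mul_of_nonneg_right hκ hM
    linarith
  have e1 : w + m * v / r = w + m * c * v / (r * (v + c)) + m / r * (v ^ 2 / (v + c)) := by
    have hP' := hP.ne
    field_simp
    ring
  -- Since c < -v/2, the denominator lies below v/2. So E falls short of the unweighted α by at most
  -- 2m|v|/r, which is covered by the bound 2m(uLo + hHi)/r₀ in `hA`.
  have h1 : 2 * v ≤ v ^ 2 / (v + c) := by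
    rw [le_div_iff_of_neg hP]
    nlinarith
  have h2 : m / r * (2 * v) ≤ m / r * (v ^ 2 / (v + c)) :=
    mul_le_mul_of_nonneg_left h1 (by positivity)
  have h3 : -(2 * m * (uLo + hHi) / r₀) ≤ m / r * (2 * v) := by
    have h4 : m / r * (2 * -v) ≤ m / r₀ * (2 * (uLo + hHi)) := by
      gcongr <;> linarith
    have h5 : m / r₀ * (2 * (uLo + hHi)) = 2 * m * (uLo + hHi) / r₀ := by ring
    linarith
  linarith

theorem mul_le_sub_of_hasDerivWithinAt {f f' : ℝ → ℝ} {σ t C : ℝ} (ht : t ∈ Ico 0 σ)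
    (hf : ∀ s ∈ Icc 0 t, HasDerivWithinAt f (f' s) (Ico 0 σ) s) (hC : ∀ s ∈ Ioo 0 t, C ≤ f' s) :
    C * t ≤ f t - f 0 := by
  have hsub : Icc 0 t ⊆ Ico 0 σ := fun s hs => ⟨hs.1, hs.2.trans_lt ht.2⟩
  have hda : ∀ s ∈ Ioo 0 t, HasDerivAt f (f' s) s := fun s hs =>
    (hf s (Ioo_subset_Icc_self hs)).hasDerivAt (Ico_mem_nhds hs.1 (hs.2.trans ht.2))
  have h := (convex_Icc 0 t).mul_sub_le_image_sub_of_le_deriv (f := f) (C := C)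
    (fun s hs => ((hf s hs).mono hsub).continuousWithinAt)
    (fun s hs => (hda s (by rwa [interior_Icc] at hs)).differentiableAt.differentiableWithinAt)
    (fun s hs => by
      rw [interior_Icc] at hs
      rw [(hda s hs).deriv]
      exact hC s hs) 0 ⟨le_rfl, ht.1⟩ t ⟨ht.1, le_rfl⟩ ht.1
  simpa using h

theorem sub_le_mul_of_hasDerivWithinAt {f f' : ℝ → ℝ} {σ t C : ℝ} (ht : t ∈ Ico 0 σ)
    (hf : ∀ s ∈ Icc 0 t, HasDerivWithinAt f (f' s) (Ico 0 σ) s) (hC : ∀ s ∈ Ioo 0 t, f' s ≤ C) :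
    f t - f 0 ≤ C * t := by
  have := mul_le_sub_of_hasDerivWithinAt (f := fun s => -f s) (f' := fun s => -f' s) (C := -C) ht
    (fun s hs => (hf s hs).neg) fun s hs => neg_le_neg (hC s hs)
  linarith

theorem dr_eq_derivWithin {f : ℝ × ℝ → ℝ} {b₁ b₂ : ℝ → ℝ} {σ r t : ℝ}
    (hf : ContDiffOn ℝ 2 f (region b₁ b₂ σ)) (hp : (r, t) ∈ region b₁ b₂ σ) (hlt : b₁ t < b₂ t) :
    derivWithin (fun x => f (x, t)) (Icc (b₁ t) (b₂ t)) r = dr (region b₁ b₂ σ) f (r, t) :=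
  ((hasPartialsWithinAt_of_contDiffOn hf hp).slice (I := Icc (b₁ t) (b₂ t))
    fun _ hx => ⟨hp.1, hx⟩).derivWithin (uniqueDiffOn_Icc hlt r hp.2)

theorem betaTilde_slice {f g : ℝ × ℝ → ℝ} {b₁ b₂ : ℝ → ℝ} {σ r t : ℝ}
    (hf : ContDiffOn ℝ 2 f (region b₁ b₂ σ)) (hg : ContDiffOn ℝ 2 g (region b₁ b₂ σ))
    (hp : (r, t) ∈ region b₁ b₂ σ) (hlt : b₁ t < b₂ t) :
    betaTilde γ m (Icc (b₁ t) (b₂ t)) (fun x => f (x, t)) (fun x => g (x, t)) r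
      = betaField γ m (region b₁ b₂ σ) f g (r, t) := by
  rw [betaTilde, dr_eq_derivWithin hf hp hlt, dr_eq_derivWithin hg hp hlt, betaField, betaPlain]

theorem betaTilde_congr {s : Set ℝ} {f f' g g' : ℝ → ℝ} (hf : EqOn f f' s) (hg : EqOn g g' s)
    {r : ℝ} (hr : r ∈ s) : betaTilde γ m s f g r = betaTilde γ m s f' g' r := by
  rw [betaTilde, betaTilde, derivWithin_congr hf (hf hr), derivWithin_congr hg (hg hr), hf hr,
    hg hr]

namespace IsSmoothSolution

variable {K τ σ : ℝ} {ρ u : ℝ → ℝ → ℝ} {b₁ b₂ : ℝ → ℝ}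

theorem betaField_init (H : IsSmoothSolution K γ m r₁ r₂ h₀ u₀ τ ρ u b₁ b₂) (hr : r₁ < r₂)
    (hE : IsEulerFlowOn γ m (region b₁ b₂ σ) (fun p => soundSpeed K γ (ρ p.1 p.2))
      (fun p => u p.1 p.2)) (hσ : 0 < σ) {r : ℝ} (hrm : r ∈ Icc r₁ r₂) :
    betaField γ m (region b₁ b₂ σ) (fun p => soundSpeed K γ (ρ p.1 p.2)) (fun p => u p.1 p.2)
      (r, 0) = betaTilde γ m (Icc r₁ r₂) h₀ u₀ r := by
  have hp : (r, 0) ∈ region b₁ b₂ σ := ⟨⟨le_rfl, hσ⟩, by rwa [H.left_init, H.right_init]⟩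
  rw [← betaTilde_slice hE.contDiffOn_soundSpeed hE.contDiffOn_velocity hp
    (by rwa [H.left_init, H.right_init]), H.left_init, H.right_init]
  exact betaTilde_congr H.init_soundSpeed H.init_velocity hrm

theorem isCompressed_of_noncollapse (H : IsSmoothSolution K γ m r₁ r₂ h₀ u₀ τ ρ u b₁ b₂)
    (D : IsInwardCompressive γ m r₀ r₁ r₂ hHi uLo uHi βLo h₀ u₀) (hK : 0 < K) (hσ : σ ≤ τ)
    (hlt : ∀ t ∈ Ico 0 σ, b₁ t < b₂ t) (hr : ∀ t ∈ Ico 0 σ, r₀ < b₁ t) :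
    ∀ p ∈ region b₁ b₂ σ, IsCompressed γ m hHi uLo uHi βLo (region b₁ b₂ σ)
      (fun p => soundSpeed K γ (ρ p.1 p.2)) (fun p => u p.1 p.2) p := by
  have hγ := D.three_le
  have hE := H.isEulerFlowOn hK (by linarith) hσ hlt fun t ht => D.radius_pos.trans (hr t ht)
  have hI : Ico 0 σ ⊆ Ico 0 τ := Ico_subset_Ico_right hσ
  refine hE.isCompressed_of_initially hγ D.one_le D.radius_pos D.uLo_pos D.hHi_lt
    (fun t ht => (H.left_char t (hI ht)).mono hI) (fun t ht => (H.right_char t (hI ht)).mono hI)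
    hlt (fun t ht => (hr t ht).le) D.compression_le ?_
  rintro ⟨r, t⟩ hp (rfl : t = 0)
  have hσ0 : 0 < σ := hp.1.2
  have hrm : r ∈ Icc r₁ r₂ := by simpa only [H.left_init, H.right_init] using hp.2
  have e1 := dr_eq_derivWithin hE.contDiffOn_soundSpeed hp (hlt 0 hp.1)
  have e2 := dr_eq_derivWithin hE.contDiffOn_velocity hp (hlt 0 hp.1)
  simp only [H.left_init, H.right_init] at e1 e2
  rw [derivWithin_congr H.init_soundSpeed (H.init_soundSpeed r hrm)] at e1
  rw [derivWithin_congr H.init_velocity (H.init_velocity r hrm)] at e2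
  obtain ⟨hw1, hw2⟩ := D.soundSpeed_bounds r hrm
  obtain ⟨hv1, hv2⟩ := D.velocity_bounds r hrm
  have hpos := D.decayRate_pos r hrm
  have e3 := H.init_soundSpeed r hrm
  have e4 := H.init_velocity r hrm
  refine ⟨?_, ?_, ?_, ?_, ?_⟩
  · simpa only [e3] using hw2
  · simpa only [e4] using hv2
  · have : 0 < 2 / (γ - 1) * h₀ r := mul_pos (div_pos two_pos (by linarith)) hw1
    simp only [e3, e4]
    linarith
  · simp only [decayRate, e4, ← e1, ← e2]
    exact hpos
  · rw [H.betaField_init D.radii_lt hE hσ0 hrm]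
    exact D.betaTilde_lt r hrm

/-- Bounds on the position of the boundary characteristics as long as the region does not
collapse. -/
theorem boundary_bounds (H : IsSmoothSolution K γ m r₁ r₂ h₀ u₀ τ ρ u b₁ b₂)
    (D : IsInwardCompressive γ m r₀ r₁ r₂ hHi uLo uHi βLo h₀ u₀) (hK : 0 < K) (hσ : σ ≤ τ)
    (hlt : ∀ t ∈ Ico 0 σ, b₁ t < b₂ t) (hr : ∀ t ∈ Ico 0 σ, r₀ < b₁ t) {t : ℝ}
    (ht : t ∈ Ico 0 τ) (htσ : t ≤ σ) :
    b₁ t ≤ r₁ ∧ r₁ - (uLo + 2 * hHi) * t ≤ b₁ t ∧ r₂ - (uLo + 2 * hHi) * t ≤ b₂ t := by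
  have hγ := D.three_le
  have hcomp := H.isCompressed_of_noncollapse D hK hσ hlt hr
  have hHi_lt := D.hHi_lt
  have bounds : ∀ p ∈ region b₁ b₂ σ, 0 < soundSpeed K γ (ρ p.1 p.2) ∧
      soundSpeed K γ (ρ p.1 p.2) < hHi ∧ u p.1 p.2 < -uHi ∧ -(uLo + hHi) ≤ u p.1 p.2 := by
    intro p hp
    have hpos := soundSpeed_pos hK (by linarith : 0 < γ)
      (H.density_pos p ⟨⟨hp.1.1, hp.1.2.trans_le hσ⟩, hp.2⟩)
    obtain ⟨h1, h2, h3, -, -⟩ := hcomp p hp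
    exact ⟨hpos, h1, h2, neg_velocity_le hγ hpos h1.le h3.le⟩
  have hsub : ∀ s ∈ Icc 0 t, s ∈ Ico 0 τ := fun s hs => ⟨hs.1, hs.2.trans_lt ht.2⟩
  have hσ' : ∀ s ∈ Ioo 0 t, s ∈ Ico 0 σ := fun s hs => ⟨hs.1.le, hs.2.trans_le htσ⟩
  have hl : ∀ s ∈ Ioo 0 t, (b₁ s, s) ∈ region b₁ b₂ σ := fun s hs =>
    ⟨hσ' s hs, le_rfl, (hlt s (hσ' s hs)).le⟩
  have hrg : ∀ s ∈ Ioo 0 t, (b₂ s, s) ∈ region b₁ b₂ σ := fun s hs =>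
    ⟨hσ' s hs, (hlt s (hσ' s hs)).le, le_rfl⟩
  have h1 := sub_le_mul_of_hasDerivWithinAt (C := 0) ht (fun s hs => H.left_char s (hsub s hs))
    fun s hs => by
      obtain ⟨q1, q2, q3, q4⟩ := bounds _ (hl s hs)
      simp only at q1 q2 q3 q4
      linarith
  have h2 := mul_le_sub_of_hasDerivWithinAt (C := -(uLo + 2 * hHi)) ht
    (fun s hs => H.left_char s (hsub s hs)) fun s hs => by
      obtain ⟨q1, q2, q3, q4⟩ := bounds _ (hl s hs)
      simp only at q1 q2 q3 q4
      linarith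
  have h3 := mul_le_sub_of_hasDerivWithinAt (C := -(uLo + 2 * hHi)) ht
    (fun s hs => H.right_char s (hsub s hs)) fun s hs => by
      obtain ⟨q1, q2, q3, q4⟩ := bounds _ (hrg s hs)
      simp only at q1 q2 q3 q4
      linarith
  rw [H.left_init] at h1 h2
  rw [H.right_init] at h3
  exact ⟨by linarith, by linarith, by linarith⟩

/-- The bounds need an uncollapsed region and in turn prevent the collapse; the circle is broken at
a first failing time. -/
theorem noncollapse (H : IsSmoothSolution K γ m r₁ r₂ h₀ u₀ τ ρ u b₁ b₂)
    (D : IsInwardCompressive γ m r₀ r₁ r₂ hHi uLo uHi βLo h₀ u₀) (hK : 0 < K) (hσ : σ ≤ τ)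
    (hσ₀ : (uLo + 2 * hHi) * σ ≤ r₁ - r₀) (hσ₁ : (uLo + 2 * hHi) * σ ≤ r₂ - r₁) :
    ∀ t ∈ Ico 0 σ, b₁ t < b₂ t ∧ r₀ < b₁ t := by
  by_contra! hcon
  obtain ⟨t₁, ht₁, hbad⟩ := hcon
  have hsub : Icc 0 t₁ ⊆ Ico 0 τ := fun s hs => ⟨hs.1, (hs.2.trans_lt ht₁.2).trans_le hσ⟩
  have hc₁ : ContinuousOn b₁ (Icc 0 t₁) := fun s hs =>
    ((H.left_char s (hsub hs)).mono hsub).continuousWithinAt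
  have hc₂ : ContinuousOn b₂ (Icc 0 t₁) := fun s hs =>
    ((H.right_char s (hsub hs)).mono hsub).continuousWithinAt
  set g : ℝ → ℝ := fun s => min (b₂ s - b₁ s) (b₁ s - r₀) with hg
  have hgc : ContinuousOn g (Icc 0 t₁) := ContinuousOn.inf (hc₂.sub hc₁) (hc₁.sub continuousOn_const)
  have hcl := hgc.preimage_isClosed_of_isClosed isClosed_Icc (isClosed_Iic (a := 0))
  have hcompact : IsCompact (Icc 0 t₁ ∩ g ⁻¹' Iic 0) :=
    isCompact_Icc.of_isClosed_subset hcl inter_subset_left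
  have hgood : ∀ s, 0 < g s ↔ b₁ s < b₂ s ∧ r₀ < b₁ s := fun s => by
    simp only [hg, lt_min_iff, sub_pos]
  obtain ⟨t, ⟨htI, htg⟩, hmin⟩ := hcompact.exists_isMinOn
    ⟨t₁, ⟨ht₁.1, le_rfl⟩, not_lt.1 fun h => by
      have := (hgood t₁).1 h
      linarith [hbad this.1]⟩ continuousOn_id
  have hearlier : ∀ s ∈ Ico 0 t, b₁ s < b₂ s ∧ r₀ < b₁ s := fun s hs => by
    rw [← hgood]
    by_contra! h
    have : t ≤ s := hmin ⟨⟨hs.1, hs.2.le.trans htI.2⟩, h⟩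
    linarith [hs.2]
  have htσ : t < σ := htI.2.trans_lt ht₁.2
  -- The end time of the region is taken to be t itself: positions at t depend only on speeds at
  -- strictly earlier times.
  obtain ⟨h1, h2, h3⟩ := H.boundary_bounds D hK (htσ.le.trans hσ) (fun s hs => (hearlier s hs).1)
    (fun s hs => (hearlier s hs).2) (hsub htI) le_rfl
  have hV : 0 < uLo + 2 * hHi := by linarith [D.hHi_pos, D.uLo_pos]
  have h4 : (uLo + 2 * hHi) * t < (uLo + 2 * hHi) * σ := mul_lt_mul_of_pos_left htσ hV
  have : 0 < g t := (hgood t).2 ⟨by linarith, by linarith⟩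
  exact absurd this (not_lt.2 htg)

end IsSmoothSolution

end Noncollapse

/-! ### Existence of the interior 1-characteristic. -/

section Characteristic

open Filter Topology
open scoped NNReal

/-- Global existence on a half-open time interval for a vector field on `ℝ` that is bounded and
Lipschitz in space, uniformly on compact time intervals. -/
theorem exists_forall_hasDerivWithinAt_Ico {V : ℝ → ℝ → ℝ} {σ : ℝ} (x₀ : ℝ)
    (hLip : ∀ T < σ, ∃ C : ℝ≥0, ∀ t ∈ Icc 0 T, LipschitzWith C (V t))
    (hbd : ∀ T < σ, ∃ L : ℝ≥0, ∀ t ∈ Icc 0 T, ∀ x, ‖V t x‖ ≤ L)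
    (hcont : ∀ x, ContinuousOn (fun t => V t x) (Ico 0 σ)) :
    ∃ X : ℝ → ℝ, X 0 = x₀ ∧ ∀ t ∈ Ico 0 σ, HasDerivWithinAt X (V t (X t)) (Ico 0 σ) t := by
  have loc : ∀ T, ∃ X : ℝ → ℝ, X 0 = x₀ ∧
      (T ∈ Ico 0 σ → ∀ t ∈ Icc 0 T, HasDerivWithinAt X (V t (X t)) (Icc 0 T) t) := by
    intro T
    by_cases hT : T ∈ Ico 0 σ
    · obtain ⟨C, hC⟩ := hLip T hT.2
      obtain ⟨L, hL⟩ := hbd T hT.2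
      have hPL : IsPicardLindelof V (⟨0, le_rfl, hT.1⟩ : Icc 0 T) x₀ (L * T.toNNReal) 0 L C :=
        { lipschitzOnWith := fun t ht => (hC t ht).lipschitzOnWith
          continuousOn := fun x _ => (hcont x).mono fun t ht => ⟨ht.1, ht.2.trans_lt hT.2⟩
          norm_le := fun t ht x _ => hL t ht x
          mul_max_le := by simp [hT.1] }
      obtain ⟨X, hX0, hX⟩ := hPL.exists_eq_forall_mem_Icc_hasDerivWithinAt₀
      exact ⟨X, hX0, fun _ => hX⟩
    · exact ⟨fun _ => x₀, rfl, fun h => absurd h hT⟩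
  choose Y hY0 hY using loc
  have agree : ∀ T ∈ Ico 0 σ, ∀ T' ∈ Ico 0 σ, T ≤ T' → EqOn (Y T) (Y T') (Icc 0 T) := by
    intro T hT T' hT' hle
    obtain ⟨C, hC⟩ := hLip T hT.2
    have hsub : Icc 0 T ⊆ Icc 0 T' := Icc_subset_Icc_right hle
    refine ODE_solution_unique_of_mem_Icc_right (v := V) (s := fun _ => univ) (K := C)
      (fun t ht => (hC t (Ico_subset_Icc_self ht)).lipschitzOnWith)
      (fun t ht => (hY T hT t ht).continuousWithinAt)
      (fun t ht => (hY T hT t (Ico_subset_Icc_self ht)).mono_of_mem_nhdsWithin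
        (Icc_mem_nhdsGE_of_mem ht)) (fun _ _ => mem_univ _)
      (fun t ht => ((hY T' hT' t (hsub ht)).mono hsub).continuousWithinAt)
      (fun t ht => ((hY T' hT' t (hsub (Ico_subset_Icc_self ht))).mono
        hsub).mono_of_mem_nhdsWithin (Icc_mem_nhdsGE_of_mem ht)) (fun _ _ => mem_univ _) ?_
    rw [hY0, hY0]
  have agree' : ∀ T ∈ Ico 0 σ, ∀ t ∈ Icc 0 T, Y t t = Y T t := fun T hT t ht =>
    agree t ⟨ht.1, ht.2.trans_lt hT.2⟩ T hT ht.2 ⟨ht.1, le_rfl⟩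
  refine ⟨fun t => Y t t, hY0 0, fun t ht => ?_⟩
  set T := (t + σ) / 2 with hTdef
  have hT : T ∈ Ico 0 σ := ⟨by linarith [ht.1, ht.2], by linarith [ht.2]⟩
  have htT : t ∈ Ico 0 T := ⟨ht.1, by linarith [ht.2]⟩
  have h1 : HasDerivWithinAt (fun s => Y s s) (V t (Y t t)) (Icc 0 T) t := by
    rw [agree' T hT t (Ico_subset_Icc_self htT)]
    exact (hY T hT t (Ico_subset_Icc_self htT)).congr (fun s hs => agree' T hT s hs)
      (agree' T hT t (Ico_subset_Icc_self htT))
  refine h1.mono_of_mem_nhdsWithin ?_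
  filter_upwards [self_mem_nhdsWithin, mem_nhdsWithin_of_mem_nhds (Iio_mem_nhds htT.2)] with s hs1 hs2
  exact ⟨hs1.1, le_of_lt hs2⟩

/-- The characteristic with speed `f` issuing from an interior point of the initial interval,
given that the right boundary is itself such a characteristic and that the speed is too small for
the left boundary to be reached. -/
theorem exists_characteristic {f : ℝ × ℝ → ℝ} {b₁ b₂ : ℝ → ℝ} {σ x₀ C : ℝ}
    (hU : UniqueDiffOn ℝ (region b₁ b₂ σ)) (hf : ContDiffOn ℝ 2 f (region b₁ b₂ σ))
    (hlt : ∀ t ∈ Ico 0 σ, b₁ t < b₂ t) (hb₁ : ContinuousOn b₁ (Ico 0 σ))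
    (hb₂ : ∀ t ∈ Ico 0 σ, HasDerivWithinAt b₂ (f (b₂ t, t)) (Ico 0 σ) t)
    (hx₀ : x₀ < b₂ 0) (hC : ∀ p ∈ region b₁ b₂ σ, C ≤ f p)
    (hlow : ∀ t ∈ Ico 0 σ, b₁ t < x₀ + C * t) :
    ∃ X : ℝ → ℝ, X 0 = x₀ ∧ ∀ t ∈ Ico 0 σ,
      X t ∈ Ioo (b₁ t) (b₂ t) ∧ HasDerivWithinAt X (f (X t, t)) (Ico 0 σ) t := by
  have hc₂ : ContinuousOn b₂ (Ico 0 σ) := fun t ht => (hb₂ t ht).continuousWithinAt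
  -- Projecting to the region extends the speed to all x, preserving boundedness and the Lipschitz
  -- constant. The solution is afterwards shown never to leave the region.
  set clamp : ℝ → ℝ → ℝ := fun t x => max (b₁ t) (min x (b₂ t)) with hclamp
  have hmem : ∀ t ∈ Ico 0 σ, ∀ x, (clamp t x, t) ∈ region b₁ b₂ σ := fun t ht x =>
    ⟨ht, le_max_left _ _, max_le (hlt t ht).le (min_le_right _ _)⟩
  have hclamp_of_mem : ∀ t, ∀ x ∈ Icc (b₁ t) (b₂ t), clamp t x = x := fun t x hx => by
    simp only [hclamp, min_eq_left hx.2, max_eq_right hx.1]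
  set V : ℝ → ℝ → ℝ := fun t x => f (clamp t x, t) with hV
  have hIcc : ∀ T < σ, Icc 0 T ⊆ Ico 0 σ := fun T hT s hs => ⟨hs.1, hs.2.trans_lt hT⟩
  have hLip : ∀ T < σ, ∃ C : ℝ≥0, ∀ t ∈ Icc 0 T, LipschitzWith C (V t) := by
    intro T hT
    obtain ⟨L, hL⟩ := (isCompact_region_le hlt hb₁ hc₂ hT).exists_bound_of_continuousOn
      ((contDiffOn_dr hU hf).continuousOn.mono fun p hp => hp.1)
    refine ⟨L.toNNReal, fun t ht => ?_⟩
    have htσ := hIcc T hT ht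
    have h1 : LipschitzOnWith L.toNNReal (fun x => f (x, t)) (Icc (b₁ t) (b₂ t)) := by
      refine (convex_Icc _ _).lipschitzOnWith_of_nnnorm_hasDerivWithin_le
        (f' := fun x => dr (region b₁ b₂ σ) f (x, t))
        (fun x hx => (hasPartialsWithinAt_of_contDiffOn hf ⟨htσ, hx⟩).slice
          fun y hy => ⟨htσ, hy⟩) fun x hx => ?_
      rw [← NNReal.coe_le_coe, coe_nnnorm]
      exact (hL (x, t) ⟨⟨htσ, hx⟩, ht.2⟩).trans (Real.le_coe_toNNReal L)
    have h2 : LipschitzWith 1 (clamp t) := (LipschitzWith.id.min_const (b₂ t)).const_max (b₁ t)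
    refine LipschitzWith.of_dist_le_mul fun x y => ?_
    refine (h1.dist_le_mul _ (hmem t htσ x).2 _ (hmem t htσ y).2).trans ?_
    have := h2.dist_le_mul x y
    simp only [NNReal.coe_one, one_mul] at this
    gcongr
  have hbd : ∀ T < σ, ∃ L : ℝ≥0, ∀ t ∈ Icc 0 T, ∀ x, ‖V t x‖ ≤ L := by
    intro T hT
    obtain ⟨L, hL⟩ := (isCompact_region_le hlt hb₁ hc₂ hT).exists_bound_of_continuousOn
      (hf.continuousOn.mono fun p hp => hp.1)
    exact ⟨L.toNNReal, fun t ht x => (hL _ ⟨hmem t (hIcc T hT ht) x, ht.2⟩).trans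
      (Real.le_coe_toNNReal L)⟩
  have hcont : ∀ x, ContinuousOn (fun t => V t x) (Ico 0 σ) := fun x => by
    refine hf.continuousOn.comp (ContinuousOn.prodMk ?_ continuousOn_id) fun t ht => hmem t ht x
    exact ContinuousOn.sup hb₁ (ContinuousOn.inf continuousOn_const hc₂)
  obtain ⟨X, hX0, hX⟩ := exists_forall_hasDerivWithinAt_Ico x₀ hLip hbd hcont
  have hlower : ∀ t ∈ Ico 0 σ, b₁ t < X t := fun t ht => by
    have h1 := mul_le_sub_of_hasDerivWithinAt (C := C) ht (fun s hs => hX s (hIcc t ht.2 hs))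
      fun s hs => hC _ (hmem s ⟨hs.1.le, hs.2.trans ht.2⟩ _)
    have h2 := hlow t ht
    rw [hX0] at h1
    linarith
  -- A meeting with b₂, which solves the same equation, would by backward uniqueness force x₀ = b₂
  -- 0.
  have hupper : ∀ t ∈ Ico 0 σ, X t < b₂ t := by
    by_contra! hcon
    obtain ⟨t₁, ht₁, hge⟩ := hcon
    have hsub := hIcc t₁ ht₁.2
    have hXc : ContinuousOn X (Icc 0 t₁) := fun s hs =>
      ((hX s (hsub hs)).mono hsub).continuousWithinAt
    obtain ⟨t₂, ht₂, heq⟩ := intermediate_value_Icc ht₁.1 (hXc.sub (hc₂.mono hsub))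
      (show (0 : ℝ) ∈ Icc _ _ from
        ⟨by simpa [hX0] using hx₀.le, by simpa using hge⟩)
    have hsub₂ : Icc 0 t₂ ⊆ Ico 0 σ := (Icc_subset_Icc_right ht₂.2).trans hsub
    obtain ⟨L, hL⟩ := hLip t₁ ht₁.2
    have huniq := ODE_solution_unique_of_mem_Icc_left (v := V) (s := fun _ => univ) (K := L)
      (f := X) (g := b₂) (a := 0) (b := t₂)
      (fun t ht => (hL t ⟨ht.1.le, ht.2.trans ht₂.2⟩).lipschitzOnWith)
      (hXc.mono (Icc_subset_Icc_right ht₂.2))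
      (fun t ht => ((hX t (hsub₂ (Ioc_subset_Icc_self ht))).mono hsub₂).mono_of_mem_nhdsWithin
        (Icc_mem_nhdsLE_of_mem ht)) (fun _ _ => mem_univ _)
      (hc₂.mono hsub₂)
      (fun t ht => by
        have htσ := hsub₂ (Ioc_subset_Icc_self ht)
        have hb : V t (b₂ t) = f (b₂ t, t) := by
          simp only [hV, hclamp_of_mem t (b₂ t) ⟨(hlt t htσ).le, le_rfl⟩]
        rw [hb]
        exact ((hb₂ t htσ).mono hsub₂).mono_of_mem_nhdsWithin (Icc_mem_nhdsLE_of_mem ht))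
      (fun _ _ => mem_univ _) (sub_eq_zero.1 heq)
    have := huniq ⟨le_rfl, ht₂.1⟩
    rw [hX0] at this
    linarith
  refine ⟨X, hX0, fun t ht => ⟨⟨hlower t ht, hupper t ht⟩, ?_⟩⟩
  have h := hX t ht
  rwa [show V t (X t) = f (X t, t) by
    simp only [hV, hclamp_of_mem t (X t) ⟨(hlower t ht).le, (hupper t ht).le⟩]] at h

end Characteristic

/-! ### Riccati inequality and breakdown. -/

section Blowup

open Filter Topology

/-- The function 1/y - k t is strictly increasing while 1/y stays negative, so 1/y(0) + k t < 0. -/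
theorem riccati_blowup {y : ℝ → ℝ} {σ k : ℝ} (hσ : 0 < σ) (hneg : ∀ t ∈ Ico 0 σ, y t < 0)
    (hy : ∀ t ∈ Ico 0 σ, ∃ d, HasDerivWithinAt y d (Ico 0 σ) t ∧ d < -(k * y t ^ 2)) :
    0 < 1 + y 0 * k * σ ∧
      ∀ t ∈ Ioo 0 σ, 0 < 1 + y 0 * k * t ∧ y t < y 0 / (1 + y 0 * k * t) := by
  have hmono : StrictMonoOn (fun t => (y t)⁻¹ - k * t) (Ico 0 σ) := by
    refine strictMonoOn_of_deriv_pos (convex_Ico 0 σ) ?_ ?_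
    · refine ContinuousOn.sub (ContinuousOn.inv₀ (fun t ht => ?_) fun t ht => (hneg t ht).ne)
        (by fun_prop)
      obtain ⟨d, hd, -⟩ := hy t ht
      exact hd.continuousWithinAt
    · intro t ht
      rw [interior_Ico] at ht
      have htI := Ioo_subset_Ico_self ht
      obtain ⟨d, hd, hlt⟩ := hy t htI
      have hd' := hd.hasDerivAt (Ico_mem_nhds ht.1 ht.2)
      have h1 : HasDerivAt (fun t => (y t)⁻¹ - k * t) (-d / y t ^ 2 - k * 1) t :=
        (hd'.fun_inv (hneg t htI).ne).sub ((hasDerivAt_id t).const_mul k)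
      rw [h1.deriv]
      have h2 : 0 < y t ^ 2 := sq_pos_of_neg (hneg t htI)
      have h3 : k < -d / y t ^ 2 := by
        rw [lt_div_iff₀ h2]
        linarith
      linarith
  have h0 : (0 : ℝ) ∈ Ico 0 σ := ⟨le_rfl, hσ⟩
  have hy0 := hneg 0 h0
  have hfac : ∀ t, 1 + y 0 * k * t = y 0 * ((y 0)⁻¹ + k * t) := fun t => by
    have := hy0.ne
    field_simp
  constructor
  -- The increase already gained by σ/2 survives the limit t → σ and keeps the inequality strict at
  -- σ.
  · have hmid : σ / 2 ∈ Ico 0 σ := ⟨by linarith, by linarith⟩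
    have h1 := hmono h0 hmid (by linarith)
    simp only [mul_zero, sub_zero] at h1
    have hlim : (y 0)⁻¹ + k * σ + ((y (σ / 2))⁻¹ - k * (σ / 2) - (y 0)⁻¹) ≤ 0 := by
      have htend : Tendsto (fun t => (y 0)⁻¹ + k * t + ((y (σ / 2))⁻¹ - k * (σ / 2) - (y 0)⁻¹))
          (𝓝[<] σ) (𝓝 ((y 0)⁻¹ + k * σ + ((y (σ / 2))⁻¹ - k * (σ / 2) - (y 0)⁻¹))) :=
        (Continuous.tendsto (by fun_prop) σ).mono_left nhdsWithin_le_nhds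
      refine le_of_tendsto htend ?_
      filter_upwards [Ioo_mem_nhdsLT (show σ / 2 < σ by linarith)] with t ht
      have htI : t ∈ Ico 0 σ := ⟨by linarith [ht.1], ht.2⟩
      have h2 := hmono hmid htI ht.1
      simp only at h2
      have h3 := inv_lt_zero.2 (hneg t htI)
      linarith
    rw [hfac]
    exact mul_pos_of_neg_of_neg hy0 (by linarith)
  · intro t ht
    have htI := Ioo_subset_Ico_self ht
    have h1 := hmono h0 htI ht.1
    simp only [mul_zero, sub_zero] at h1
    have h2 := inv_lt_zero.2 (hneg t htI)
    have h3 : (y 0)⁻¹ + k * t < 0 := by linarith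
    rw [hfac]
    refine ⟨mul_pos_of_neg_of_neg hy0 h3, ?_⟩
    rw [div_mul_cancel_left₀ hy0.ne, lt_inv_of_neg (hneg t htI) h3]
    linarith

theorem IsEulerFlowOn.betaField_riccati {γ : ℝ} {m : ℕ} {S : Set (ℝ × ℝ)} {h u : ℝ × ℝ → ℝ}
    {p : ℝ × ℝ} {r₀ hHi uLo uHi βLo : ℝ} (H : IsEulerFlowOn γ m S h u) (hp : p ∈ S) (hγ : 3 ≤ γ)
    (hm : 1 ≤ m) (hr₀ : 0 < r₀) (huLo : 0 < uLo) (hHi_lt : hHi < uHi / 2)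
    (hβM : hHi ^ weightExp γ * (8 * m * (uLo + hHi) / r₀) ≤ βLo)
    (hc : IsCompressed γ m hHi uLo uHi βLo S h u p) :
    betaField γ m S h u p < 0 ∧ ∃ a b, HasPartialsWithinAt (betaField γ m S h u) a b S p ∧
      (u p - h p) * a + b < -(hHi ^ (-weightExp γ) * betaField γ m S h u p ^ 2) := by
  obtain ⟨q1, q2, q3, q4, q5⟩ := hc
  have hpos := H.soundSpeed_pos p hp
  have hr := H.radius_pos p hp
  have hHi_pos := hpos.trans q1
  have hm' : (1 : ℝ) ≤ m := by exact_mod_cast hm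
  have hβ0 : 0 < βLo := lt_of_lt_of_le (by positivity) hβM
  have hκ := Real.rpow_le_rpow hpos.le q1.le (weightExp_nonneg hγ)
  have hκpos := Real.rpow_pos_of_pos hpos (weightExp γ)
  have hneg : betaField γ m S h u p < 0 := by linarith
  have hB : betaPlain γ m S h u p < 0 := by
    rw [betaField] at hneg
    exact (pos_iff_neg_of_mul_neg hneg).1 hκpos
  obtain ⟨a, b, hab, heq⟩ := H.partials_betaField (by linarith) hp (by linarith) (by linarith)
  refine ⟨hneg, a, b, hab, ?_⟩
  have hsrc := beta_source_lt hγ hm' hr hpos (by linarith : u p < -2 * h p) q4.le hB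
  rw [heq]
  refine (mul_lt_mul_of_pos_left hsrc hκpos).trans_le ?_
  rw [betaField, Real.rpow_neg hHi_pos.le]
  generalize hHi ^ weightExp γ = z at *
  generalize h p ^ weightExp γ = x at *
  have hz : 0 < z := hκpos.trans_le hκ
  have h2 : z⁻¹ * x ≤ 1 := by
    rwa [inv_mul_le_iff₀ hz, mul_one]
  have h3 := mul_le_mul_of_nonneg_right h2
    (mul_nonneg hκpos.le (sq_nonneg (betaPlain γ m S h u p)))
  linarith

theorem IsSmoothSolution.riccati_along_characteristic {K γ : ℝ} {m : ℕ}
    {r₀ r₁ r₂ hHi uLo uHi βLo τ σ rs : ℝ} {h₀ u₀ : ℝ → ℝ} {ρ u : ℝ → ℝ → ℝ} {b₁ b₂ : ℝ → ℝ}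
    (H : IsSmoothSolution K γ m r₁ r₂ h₀ u₀ τ ρ u b₁ b₂)
    (D : IsInwardCompressive γ m r₀ r₁ r₂ hHi uLo uHi βLo h₀ u₀) (hK : 0 < K) (hσ₀ : 0 < σ)
    (hσ : σ ≤ τ) (hrs : rs ∈ Ioo r₁ r₂) (hσr : (uLo + 2 * hHi) * σ ≤ r₁ - r₀)
    (hσs : (uLo + 2 * hHi) * σ ≤ rs - r₁) :
    0 < 1 + betaTilde γ m (Icc r₁ r₂) h₀ u₀ rs * hHi ^ (-weightExp γ) * σ ∧
      ∃ X : ℝ → ℝ, X 0 = rs ∧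
        (∀ t ∈ Ico 0 σ, X t ∈ Ioo (b₁ t) (b₂ t) ∧
          HasDerivWithinAt X (u (X t) t - soundSpeed K γ (ρ (X t) t)) (Ico 0 σ) t) ∧
        ∀ t ∈ Ioo 0 σ,
          0 < 1 + betaTilde γ m (Icc r₁ r₂) h₀ u₀ rs * hHi ^ (-weightExp γ) * t ∧
          betaTilde γ m (Icc (b₁ t) (b₂ t)) (fun x => soundSpeed K γ (ρ x t))
              (fun x => u x t) (X t)
            < betaTilde γ m (Icc r₁ r₂) h₀ u₀ rs /
              (1 + betaTilde γ m (Icc r₁ r₂) h₀ u₀ rs * hHi ^ (-weightExp γ) * t) := by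
  have hγ := D.three_le
  have hHi_pos := D.hHi_pos
  have hHi_lt := D.hHi_lt
  have hV : 0 < uLo + 2 * hHi := by linarith [D.uLo_pos]
  have hnc := H.noncollapse D hK hσ hσr (hσs.trans (by linarith [hrs.2]))
  have hlt : ∀ t ∈ Ico 0 σ, b₁ t < b₂ t := fun t ht => (hnc t ht).1
  have hr : ∀ t ∈ Ico 0 σ, r₀ < b₁ t := fun t ht => (hnc t ht).2
  have hE := H.isEulerFlowOn hK (by linarith) hσ hlt fun t ht => D.radius_pos.trans (hr t ht)
  have hcomp := H.isCompressed_of_noncollapse D hK hσ hlt hr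
  have hI : Ico 0 σ ⊆ Ico 0 τ := Ico_subset_Ico_right hσ
  have hbeta0 := fun {r : ℝ} => H.betaField_init (r := r) D.radii_lt hE hσ₀
  have hslice := fun {r t : ℝ} => betaTilde_slice (γ := γ) (m := m) (r := r) (t := t)
    hE.contDiffOn_soundSpeed hE.contDiffOn_velocity
  obtain ⟨X, hX0, hX⟩ := exists_characteristic (x₀ := rs) (C := -(uLo + 2 * hHi))
    hE.uniqueDiffOn (hE.contDiffOn_velocity.sub hE.contDiffOn_soundSpeed) hlt
    (fun t ht => ((H.left_char t (hI ht)).mono hI).continuousWithinAt)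
    (fun t ht => (H.right_char t (hI ht)).mono hI) (by rw [H.right_init]; exact hrs.2)
    (fun p hp => by
      obtain ⟨q1, -, q3, -, -⟩ := hcomp p hp
      have q4 := neg_velocity_le hγ (hE.soundSpeed_pos p hp) q1.le q3.le
      simp only at q1 q4
      change -(uLo + 2 * hHi) ≤ u p.1 p.2 - soundSpeed K γ (ρ p.1 p.2)
      linarith)
    (fun t ht => by
      have h1 := (H.boundary_bounds D hK hσ hlt hr (hI ht) ht.2.le).1
      have h2 := mul_lt_mul_of_pos_left ht.2 hV
      linarith)
  have hXm : ∀ t ∈ Ico 0 σ, (X t, t) ∈ region b₁ b₂ σ := fun t ht =>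
    ⟨ht, Ioo_subset_Icc_self (hX t ht).1⟩
  have hode := fun t (ht : t ∈ Ico 0 σ) => hE.betaField_riccati (hXm t ht) hγ D.one_le D.radius_pos
    D.uLo_pos hHi_lt D.compression_le (hcomp _ (hXm t ht))
  have hric := riccati_blowup (k := hHi ^ (-weightExp γ)) (y := fun t => betaField γ m
    (region b₁ b₂ σ) (fun p => soundSpeed K γ (ρ p.1 p.2)) (fun p => u p.1 p.2) (X t, t)) hσ₀
    (fun t ht => (hode t ht).1)
    (fun t ht => by
      obtain ⟨-, a, b, hab, hlt'⟩ := hode t ht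
      exact ⟨_, hab.comp_curve (hX t ht).2 hXm, hlt'⟩)
  simp only [hX0, hbeta0 (Ioo_subset_Icc_self hrs)] at hric
  refine ⟨hric.1, X, hX0, hX, fun t ht => ?_⟩
  have htI := Ioo_subset_Ico_self ht
  rw [hslice (hXm t htI) (hlt t htI)]
  exact hric.2 t ht

end Blowup

end RadialEuler

open RadialEuler in
theorem mainTheorem1
    (K γ : ℝ) (hK : 0 < K) (hγ : 3 ≤ γ) (m : ℕ) (hm : 1 ≤ m)
    (r₀ r₁ r₂ : ℝ) (hr₀ : 0 < r₀) (hr₁ : r₀ < r₁) (hr₂ : r₁ < r₂)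
    (hLo hHi uLo uHi αLo αHi βLo : ℝ)
    (hLo_pos : 0 < hLo) (hHi_pos : 0 < hHi) (uLo_pos : 0 < uLo) (uHi_pos : 0 < uHi)
    (αLo_pos : 0 < αLo) (αHi_pos : 0 < αHi) (βLo_pos : 0 < βLo)
    (h₀ u₀ : ℝ → ℝ)
    (h₀_smooth : ContDiffOn ℝ 1 h₀ (Set.Icc r₁ r₂))
    (u₀_smooth : ContDiffOn ℝ 1 u₀ (Set.Icc r₁ r₂))
    -- the initial data are a supersonic inward wave
    (hHi_lt : hHi < uHi / 2)
    (h₀_bounds : ∀ r ∈ Set.Icc r₁ r₂, hLo < h₀ r ∧ h₀ r < hHi)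
    (u₀_bounds : ∀ r ∈ Set.Icc r₁ r₂, -uLo < u₀ r ∧ u₀ r < -uHi)
    -- bounds on the weighted gradient variables of the data
    (α₀_bounds : ∀ r ∈ Set.Icc r₁ r₂,
      αLo < alphaTilde γ m (Set.Icc r₁ r₂) h₀ u₀ r ∧
        alphaTilde γ m (Set.Icc r₁ r₂) h₀ u₀ r < αHi)
    (β₀_bound : ∀ r ∈ Set.Icc r₁ r₂, betaTilde γ m (Set.Icc r₁ r₂) h₀ u₀ r < -βLo)
    (αLo_ge : 2 * m * (uLo + hHi) / r₀ * hHi ^ weightExp γ ≤ αLo)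
    (βLo_gt : (γ + 1) * r₂ * αLo ^ 2 / (2 * m * uLo) * hLo ^ (-weightExp γ) < βLo)
    (T : ℝ) (hT_pos : 0 < T) (hT : T ≤ maxTime γ r₀ r₁ hLo hHi uLo αHi)
    -- strong compression at one point
    (rs : ℝ) (hrs : rs ∈ Set.Ioo r₁ r₂)
    (h_compr : hHi ^ (-weightExp γ) * betaTilde γ m (Set.Icc r₁ r₂) h₀ u₀ rs
      ≤ -threshold γ r₁ hHi uLo βLo T rs) :
    1 / threshold γ r₁ hHi uLo βLo T rs ≤ T ∧
    ∀ (τ : ℝ) (ρ u : ℝ → ℝ → ℝ) (b₁ b₂ : ℝ → ℝ), 0 < τ →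
      IsSmoothSolution K γ m r₁ r₂ h₀ u₀ τ ρ u b₁ b₂ →
      -- the smooth solution breaks down before the time `1/N`
      τ < 1 / threshold γ r₁ hHi uLo βLo T rs ∧
      -- blow-up rate of `β̃` along the 1-characteristic issuing from `rs`
      ∃ X : ℝ → ℝ, X 0 = rs ∧
        (∀ t ∈ Set.Ico 0 τ, X t ∈ Set.Ioo (b₁ t) (b₂ t) ∧
          HasDerivWithinAt X (u (X t) t - soundSpeed K γ (ρ (X t) t)) (Set.Ico 0 τ) t) ∧
        ∀ t ∈ Set.Ioo 0 τ,
          0 < 1 + betaTilde γ m (Set.Icc r₁ r₂) h₀ u₀ rs * hHi ^ (-weightExp γ) * t ∧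
          betaTilde γ m (Set.Icc (b₁ t) (b₂ t)) (fun x => soundSpeed K γ (ρ x t))
              (fun x => u x t) (X t)
            < betaTilde γ m (Set.Icc r₁ r₂) h₀ u₀ rs /
              (1 + betaTilde γ m (Set.Icc r₁ r₂) h₀ u₀ rs * hHi ^ (-weightExp γ) * t) := by
  have D := IsInwardCompressive.of_bounds hγ hm hr₀ hr₁ hr₂ hLo_pos uLo_pos hHi_lt h₀_bounds
    u₀_bounds α₀_bounds β₀_bound αLo_ge βLo_gt
  have hV : 0 < uLo + 2 * hHi := by linarith
  have hNT : 1 / T ≤ threshold γ r₁ hHi uLo βLo T rs :=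
    (le_max_left _ _).trans (le_max_right _ _)
  have hNr : (uLo + 2 * hHi) / (rs - r₁) ≤ threshold γ r₁ hHi uLo βLo T rs :=
    (le_max_right _ _).trans (le_max_right _ _)
  generalize threshold γ r₁ hHi uLo βLo T rs = N at *
  have hN : 0 < N := (one_div_pos.2 hT_pos).trans_le hNT
  have hle : 1 / N ≤ T := (one_div_le hN hT_pos).2 hNT
  refine ⟨hle, fun τ ρ u b₁ b₂ hτ H => ?_⟩
  -- The argument runs only to min τ (1/N), where the distance estimates are available. The Riccati
  -- conclusion there gives N · min τ (1/N) < 1, so the minimum is τ.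
  have hσ₀ : 0 < min τ (1 / N) := lt_min hτ (one_div_pos.2 hN)
  have hσN : min τ (1 / N) ≤ 1 / N := min_le_right _ _
  have hσr : (uLo + 2 * hHi) * min τ (1 / N) ≤ r₁ - r₀ := by
    have h1 := (hσN.trans hle).trans (hT.trans (min_le_left _ _))
    rw [le_div_iff₀ hV] at h1
    linarith
  have hσs : (uLo + 2 * hHi) * min τ (1 / N) ≤ rs - r₁ := by
    have hpos : 0 < rs - r₁ := sub_pos.2 hrs.1
    rw [div_le_iff₀ hpos] at hNr
    have h1 := mul_le_mul_of_nonneg_left hσN hV.le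
    refine h1.trans ?_
    rw [mul_one_div, div_le_iff₀ hN]
    linarith
  have hmain := H.riccati_along_characteristic D hK hσ₀ (min_le_left _ _) hrs hσr hσs
  have hσlt : min τ (1 / N) < 1 / N := by
    have h1 := hmain.1
    rw [lt_div_iff₀ hN]
    have h2 := mul_le_mul_of_nonneg_right h_compr hσ₀.le
    linarith
  have hστ : min τ (1 / N) = τ := min_eq_left (by
    by_contra! h
    exact hσlt.ne (min_eq_right h.le))
  rw [hστ] at hmain hσlt
  exact ⟨hσlt, hmain.2⟩
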